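/- Let $N\ge 1$ and $0<\theta\le 2$, and let $\Gamma_\theta(x,t)=(2\pi)^{-N}\int_{\mathbb R^N}e^{ix\cdot\xi-t|\xi|^\theta}\,d\xi$ be the fundamental solution of $\partial_t u+(-\Delta)^{\theta/2}u=0$ in $\mathbb R^N\times(0,\infty)$. For a nonnegative Borel measure $\nu$ on $\mathbb R^N$ put $[S(t)\nu](x)=\int_{\mathbb R^N}\Gamma_\theta(x-y,t)\,d\nu(y)\in[0,\infty]$, and identify a nonnegative Lebesgue measurable function $\mu$ with the measure $\mu(x)\,dx$. For real functions $f_1,f_2$ defined near $+\infty$ write $f_1\preceq f_2$ (equivalently $f_2\succeq f_1$) if there is $C>0$ with $f_1(\tau)\le Cf_2(\tau)$ for all large $\tau$, and $f_1\asymp f_2$ if $f_1\preceq f_2$ and $f_2\preceq f_1$. "Increasing" and "decreasing" are meant in the non-strict sense. For $T>0$ let $Q_T=\mathbb R^N\times(0,T)$. A solution of the problem $$\partial_t u+(-\Delta)^{\theta/2}u=F(u)\ \text{ in } Q_T,\qquad u(0)=\mu,\tag{P}$$ is a nonnegative measurable function $u$ on $Q_T$, finite almost everywhere, with $$u(x,t)=[S(t)\mu](x)+\int_0^t\int_{\mathbb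 R^N}\Gamma_\theta(x-y,t-s)F(u(y,s))\,dy\,ds\quad\text{for a.a. }(x,t)\in Q_T.$$ **Theorem 4.3.** Let $F:[0,\infty)\to[0,\infty)$ be increasing and continuous, and suppose * (C1) there are $R\ge 0$ and $d>1$ such that $\tau\mapsto\tau^{-d}F(\tau)$ is positive and increasing on $(R,\infty)$. Let $G:[R,\infty)\to\mathbb R$ be a continuous function such that * (C2) there is $p\in[d,d+1)$ with $G(\tau)\succeq\tau^{-p}F(\tau)>0$ as $\tau\to\infty$; * (C3) for all $a\ge 1$, $b>0$ and $c\in\mathbb R$, $G(a\tau^bG(\tau)^c)\asymp G(\tau)$ as $\tau\to\infty$; * (C4) there is $\delta\in(0,1)$ such that $\tau\mapsto\tau^{-\delta}G(\tau)$ is decreasing on $(R,\infty)$. Then for every $\alpha>1$ there exists $\varepsilon>0$ such that the following holds. If $\mu$ is a nonnegative Lebesgue measurable function on $\mathbb R^N$ with $$\sup_{x\in\mathbb R^N}\left[\frac{1}{|B(x,\sigma)|}\int_{B(x,\sigma)}\mu(y)^\alpha\,dy\right]^{1/\alpha}\le\varepsilon\,\sigma^{-\frac{\theta}{p-1}}G(\sigma^{-1})^{-\frac1{p-1}}\quad\text{for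 all small enough }\sigma>0,$$ then for some $T>0$ problem (P) has a solution $u$ in $Q_T$, and there is $C>0$ such that $$0\le u(x,t)\le 2\,[S(t)\mu^\alpha](x)^{1/\alpha}+R\le C\,t^{-\frac1{p-1}}G(t^{-1})^{-\frac1{p-1}}\quad\text{for all }(x,t)\in Q_T.$$ -/

import Mathlib

open MeasureTheory Set Filter Topology
open scoped ENNReal

namespace FracHeat

/-- `f₁(τ) ⪯ f₂(τ)` as `τ → ∞`: there is `C > 0` with `f₁ τ ≤ C f₂ τ` for all large `τ`. -/
def AsympLE (f₁ f₂ : ℝ → ℝ) : Prop :=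
  ∃ C : ℝ, 0 < C ∧ ∀ᶠ τ in atTop, f₁ τ ≤ C * f₂ τ

/-- `f₁(τ) ≍ f₂(τ)` as `τ → ∞`: both `f₁ ⪯ f₂` and `f₂ ⪯ f₁`. -/
def AsympEq (f₁ f₂ : ℝ → ℝ) : Prop :=
  AsympLE f₁ f₂ ∧ AsympLE f₂ f₁

/-- The fundamental solution `Γ_θ(x, t)` of `∂ₜ u + (-Δ)^(θ/2) u = 0` in `ℝᴺ × (0, ∞)`, i.e. the
inverse Fourier transform of `ξ ↦ exp (-t |ξ|^θ)`:
`Γ_θ(x, t) = (2π)⁻ᴺ ∫ exp (i x·ξ) exp (-t |ξ|^θ) dξ`.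
The sine part of `exp (i x·ξ)` is odd in `ξ` and integrates to zero, so only the cosine remains. -/
noncomputable def fundSol {N : ℕ} (θ : ℝ) (x : EuclideanSpace ℝ (Fin N)) (t : ℝ) : ℝ :=
  ((2 * Real.pi) ^ N)⁻¹ *
    ∫ ξ : EuclideanSpace ℝ (Fin N), Real.cos (inner ℝ x ξ) * Real.exp (-t * ‖ξ‖ ^ θ)

/-- `[S(t)ν](x) = ∫ Γ_θ(x - y, t) dν(y)`, possibly infinite. -/
noncomputable def semigroup {N : ℕ} (θ : ℝ) (t : ℝ) (ν : Measure (EuclideanSpace ℝ (Fin N)))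
    (x : EuclideanSpace ℝ (Fin N)) : ℝ≥0∞ :=
  ∫⁻ y, ENNReal.ofReal (fundSol θ (x - y) t) ∂ν

/-- The space-time cylinder `Q_T = ℝᴺ × (0, T)`. -/
def cylinder (N : ℕ) (T : ℝ) : Set (EuclideanSpace ℝ (Fin N) × ℝ) :=
  univ ×ˢ Ioo 0 T

/-- `u` is a solution in `Q_T` of `∂ₜ u + (-Δ)^(θ/2) u = F(u)`, `u(0) = ν`: a nonnegative (finite)
Lebesgue measurable function on `Q_T` such that
`u(x,t) = ∫ Γ_θ(x-y,t) dν(y) + ∫₀ᵗ ∫ Γ_θ(x-y,t-s) F(u(y,s)) dy ds` for a.a. `(x,t) ∈ Q_T`.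
Both integrals are taken in `[0, ∞]`; since the left side is finite, so is the right side, almost
everywhere. (`AEMeasurable` for the Lebesgue measure is Lebesgue measurability.) -/
structure IsSolution {N : ℕ} (θ : ℝ) (F : ℝ → ℝ) (ν : Measure (EuclideanSpace ℝ (Fin N)))
    (T : ℝ) (u : EuclideanSpace ℝ (Fin N) → ℝ → ℝ) : Prop where
  aemeasurable : AEMeasurable (Function.uncurry u) (volume.restrict (cylinder N T))
  nonneg : ∀ x, ∀ t ∈ Ioo 0 T, 0 ≤ u x t
  integral_eq : ∀ᵐ z ∂(volume.restrict (cylinder N T)),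
    ENNReal.ofReal (u z.1 z.2) =
      semigroup θ z.2 ν z.1 +
        ∫⁻ s in Ioo 0 z.2, ∫⁻ y,
          ENNReal.ofReal (fundSol θ (z.1 - y) (z.2 - s)) * ENNReal.ofReal (F (u y s))

end FracHeat

/-! Write h(t) = t^(-1/(p-1)) G(1/t)^(-1/(p-1)) (`profile`) and V(t) = S(t)μ^α. The solution comes
from monotone iteration below the supersolution U = 2 V^(1/α) + R
(`exists_isSolution_of_supersolution`). Half of the factor 2 pays for the linear part, since S(t)μ ≤
V^(1/α) by Jensen; the other half, together with R, must pay for the Duhamel integral of F(U).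

The averaging hypothesis at radius σ = t^(1/θ) gives V^(1/α) ≤ b h with b as small as desired, and h
→ ∞ as t → 0, so R ≤ U ≤ 4bh ≤ h for short times. Monotonicity of τ^(-d) F(τ) then gives F(U) ≤
(4b)^(d-α) U^α h^(1-α) F(h)/h, provided α ≤ d, and (C2), (C3) give F(h)/h ≤ C/s at time s. The
semigroup property turns S(t-s)V(s) into V(t), independent of s, so only the integral of
h(s)^(1-α)/s over (0,t) remains; (C4) bounds it by C h(t)^(1-α). Finally h^(1-α) V ≤ b^(α-1)
V^(1/α), so the Duhamel term carries the factor b^(d-1), which is small because d > 1. An exponent α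
too large for this argument is first lowered by Jensen.

The kernel must be nonnegative with mass one, satisfy the semigroup law, and have S(t)f bounded by
averages of f over balls of radius t^(1/θ). The basis is that Γ_θ is nonnegative and radially
decreasing (`fundSol_radDec`): exp(-t|ξ|^θ) is a limit of nonnegative mixtures of Gaussians in ξ.
Nonnegativity makes the kernel integrable, which opens Fourier inversion, and radial monotonicity
gives the bound by averages (`heat_le_iSup_setLAverage`) without any decay estimate. -/

namespace FracHeat

/-! ### Radially decreasing kernels -/

/-- A nonnegative function on a normed space which is a nonincreasing function of the norm. -/
structure RadDec {E : Type*} [NormedAddCommGroup E] (K : E → ℝ) : Prop where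
  nonneg : ∀ x, 0 ≤ K x
  anti : ∀ x y, ‖x‖ ≤ ‖y‖ → K y ≤ K x

section RadDec

variable {E : Type*} [NormedAddCommGroup E]

theorem RadDec.add {K L : E → ℝ} (hK : RadDec K) (hL : RadDec L) :
    RadDec fun x => K x + L x :=
  ⟨fun x => add_nonneg (hK.nonneg x) (hL.nonneg x),
    fun x y h => add_le_add (hK.anti x y h) (hL.anti x y h)⟩

theorem RadDec.const_mul {K : E → ℝ} (hK : RadDec K) {c : ℝ} (hc : 0 ≤ c) :
    RadDec fun x => c * K x :=
  ⟨fun x => mul_nonneg hc (hK.nonneg x),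
    fun x y h => mul_le_mul_of_nonneg_left (hK.anti x y h) hc⟩

theorem RadDec.of_tendsto {ι : Type*} {l : Filter ι} [l.NeBot] {K : ι → E → ℝ} {L : E → ℝ}
    (hK : ∀ᶠ i in l, RadDec (K i)) (h : ∀ x, Tendsto (fun i => K i x) l (𝓝 (L x))) :
    RadDec L :=
  ⟨fun x => ge_of_tendsto (h x) (hK.mono fun _ hi => hi.nonneg x),
    fun x y hxy => le_of_tendsto_of_tendsto (h y) (h x) (hK.mono fun _ hi => hi.anti x y hxy)⟩

theorem RadDec.integral {Ω : Type*} [MeasurableSpace Ω] {ρ : Measure Ω} {K : Ω → E → ℝ}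
    (hK : ∀ᵐ r ∂ρ, RadDec (K r)) (hi : ∀ x, Integrable (fun r => K r x) ρ) :
    RadDec fun x => ∫ r, K r x ∂ρ :=
  ⟨fun x => integral_nonneg_of_ae (hK.mono fun _ h => h.nonneg x),
    fun x y hxy => integral_mono_ae (hi y) (hi x) (hK.mono fun _ h => h.anti x y hxy)⟩

end RadDec

/-! ### Functions of `|ξ|²` with a nonnegative, radially decreasing Fourier transform -/

/-- The (unnormalised) Fourier transform of `ξ ↦ f (|ξ|²) exp (-s |ξ|²)`. -/
noncomputable def gaussFourier (N : ℕ) (f : ℝ → ℝ) (s : ℝ) (x : EuclideanSpace ℝ (Fin N)) : ℝ :=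
  ∫ ξ : EuclideanSpace ℝ (Fin N),
    Real.cos (inner ℝ x ξ) * (f (‖ξ‖ ^ 2) * Real.exp (-s * ‖ξ‖ ^ 2))

theorem integrable_exp_neg_mul_norm_sq {N : ℕ} {s : ℝ} (hs : 0 < s) :
    Integrable fun ξ : EuclideanSpace ℝ (Fin N) => Real.exp (-s * ‖ξ‖ ^ 2) := by
  have h := (GaussianFourier.integrable_cexp_neg_mul_sq_norm_add (b := (s : ℂ))
    (by simpa using hs) 0 (0 : EuclideanSpace ℝ (Fin N))).norm
  refine h.congr (Eventually.of_forall fun ξ => ?_)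
  simp only [Complex.norm_exp]
  congr 1
  simp [← Complex.ofReal_pow]

/-- Real part of the complex Gaussian integral. The right-hand side is visibly positive and
decreasing in the norm, which starts the whole class `GaussPos`. -/
theorem gaussFourier_one (N : ℕ) {s : ℝ} (hs : 0 < s) (x : EuclideanSpace ℝ (Fin N)) :
    gaussFourier N (fun _ => 1) s x =
      (Real.pi / s) ^ ((N : ℝ) / 2) * Real.exp (-(‖x‖ ^ 2 / (4 * s))) := by
  have h := GaussianFourier.integral_cexp_neg_mul_sq_norm_add (b := (s : ℂ))
    (by simpa using hs) Complex.I x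
  have hint := GaussianFourier.integrable_cexp_neg_mul_sq_norm_add (b := (s : ℂ))
    (by simpa using hs) Complex.I x
  have h2 := congrArg Complex.re h
  have hre := integral_re (𝕜 := ℂ) hint
  simp only [RCLike.re_eq_complex_re] at hre
  rw [← hre] at h2
  have hR : ((Real.pi / s : ℂ) ^ ((Module.finrank ℝ (EuclideanSpace ℝ (Fin N)) : ℂ) / 2) *
      Complex.exp (Complex.I ^ 2 * (‖x‖ : ℂ) ^ 2 / (4 * (s : ℂ)))) =
      (((Real.pi / s) ^ ((N : ℝ) / 2) * Real.exp (-(‖x‖ ^ 2 / (4 * s))) : ℝ) : ℂ) := by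
    have : (Real.pi / s : ℂ) = ((Real.pi / s : ℝ) : ℂ) := by push_cast; rfl
    rw [this, Complex.ofReal_mul, Complex.ofReal_cpow (by positivity)]
    push_cast
    simp only [finrank_euclideanSpace, Fintype.card_fin, Complex.I_sq]
    congr 2
    ring
  rw [hR, Complex.ofReal_re] at h2
  rw [← h2, gaussFourier]
  congr 1 with ξ
  rw [Complex.exp_re]
  have e1 : (-(s : ℂ) * (‖ξ‖ : ℂ) ^ 2 + Complex.I * (inner ℝ x ξ : ℝ)).re = -s * ‖ξ‖ ^ 2 := by
    simp [← Complex.ofReal_pow]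
  have e2 : (-(s : ℂ) * (‖ξ‖ : ℂ) ^ 2 + Complex.I * (inner ℝ x ξ : ℝ)).im = inner ℝ x ξ := by
    simp [← Complex.ofReal_pow]
  rw [e1, e2]
  ring

/-- `f` is measurable, bounded on `[0, ∞)`, and all the functions `ξ ↦ f (|ξ|²) exp (-s |ξ|²)`
have nonnegative, radially decreasing Fourier transforms. -/
structure GaussPos (N : ℕ) (f : ℝ → ℝ) : Prop where
  meas : Measurable f
  bdd : ∃ C, ∀ l, 0 ≤ l → |f l| ≤ C
  radDec : ∀ s, 0 < s → RadDec (gaussFourier N f s)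

theorem integrable_gaussFourier {N : ℕ} {f : ℝ → ℝ} (hf : Measurable f)
    (hb : ∃ C, ∀ l, 0 ≤ l → |f l| ≤ C) {s : ℝ} (hs : 0 < s) (x : EuclideanSpace ℝ (Fin N)) :
    Integrable fun ξ : EuclideanSpace ℝ (Fin N) =>
      Real.cos (inner ℝ x ξ) * (f (‖ξ‖ ^ 2) * Real.exp (-s * ‖ξ‖ ^ 2)) := by
  obtain ⟨C, hC⟩ := hb
  refine ((integrable_exp_neg_mul_norm_sq (N := N) hs).const_mul C).mono' ?_
    (Eventually.of_forall fun ξ => ?_)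
  · have : Measurable fun ξ : EuclideanSpace ℝ (Fin N) => f (‖ξ‖ ^ 2) :=
      hf.comp (by fun_prop)
    exact (Measurable.mul (by fun_prop) (this.mul (by fun_prop))).aestronglyMeasurable
  · rw [norm_mul, norm_mul, Real.norm_eq_abs, Real.norm_eq_abs, Real.norm_eq_abs, Real.abs_exp]
    have h1 := Real.abs_cos_le_one (inner ℝ x ξ)
    have h2 := hC (‖ξ‖ ^ 2) (by positivity)
    calc _ ≤ 1 * (C * Real.exp (-s * ‖ξ‖ ^ 2)) := by gcongr
      _ = _ := one_mul _

namespace GaussPos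

variable {N : ℕ}

theorem one : GaussPos N fun _ => 1 where
  meas := measurable_const
  bdd := ⟨1, by simp⟩
  radDec s hs := by
    refine ⟨fun x => ?_, fun x y h => ?_⟩
    · rw [gaussFourier_one N hs]; positivity
    · rw [gaussFourier_one N hs, gaussFourier_one N hs]; gcongr

theorem add {f g : ℝ → ℝ} (hf : GaussPos N f) (hg : GaussPos N g) :
    GaussPos N fun l => f l + g l where
  meas := hf.meas.add hg.meas
  bdd := by
    obtain ⟨C, hC⟩ := hf.bdd
    obtain ⟨D, hD⟩ := hg.bdd
    exact ⟨C + D, fun l hl => (abs_add_le _ _).trans (add_le_add (hC l hl) (hD l hl))⟩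
  radDec s hs := by
    convert (hf.radDec s hs).add (hg.radDec s hs) using 2 with x
    rw [gaussFourier, gaussFourier, gaussFourier,
      ← integral_add (integrable_gaussFourier hf.meas hf.bdd hs x)
        (integrable_gaussFourier hg.meas hg.bdd hs x)]
    congr 1 with ξ
    ring

theorem const_mul {f : ℝ → ℝ} (hf : GaussPos N f) {c : ℝ} (hc : 0 ≤ c) :
    GaussPos N fun l => c * f l where
  meas := hf.meas.const_mul c
  bdd := by
    obtain ⟨C, hC⟩ := hf.bdd
    refine ⟨c * C, fun l hl => ?_⟩
    rw [abs_mul, abs_of_nonneg hc]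
    exact mul_le_mul_of_nonneg_left (hC l hl) hc
  radDec s hs := by
    convert (hf.radDec s hs).const_mul hc using 2 with x
    rw [gaussFourier, gaussFourier, ← integral_const_mul]
    congr 1 with ξ
    ring

/-- The Gaussian factor with s > 0 supplies the dominating function, so bounded symbols need no
integrability of their own. -/
theorem of_tendsto {f : ℕ → ℝ → ℝ} {g : ℝ → ℝ} (hf : ∀ n, GaussPos N (f n)) {C : ℝ}
    (hC : ∀ n l, 0 ≤ l → |f n l| ≤ C) (hg : Measurable g)
    (h : ∀ l, 0 ≤ l → Tendsto (fun n => f n l) atTop (𝓝 (g l))) : GaussPos N g where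
  meas := hg
  bdd := ⟨C, fun l hl => le_of_tendsto' (h l hl).abs fun n => hC n l hl⟩
  radDec s hs := by
    refine RadDec.of_tendsto (l := atTop)
      (Eventually.of_forall fun n => (hf n).radDec s hs) fun x => ?_
    refine tendsto_integral_of_dominated_convergence
      (fun ξ : EuclideanSpace ℝ (Fin N) => C * Real.exp (-s * ‖ξ‖ ^ 2))
      (fun n => (integrable_gaussFourier (hf n).meas (hf n).bdd hs x).aestronglyMeasurable)
      ((integrable_exp_neg_mul_norm_sq hs).const_mul C)
      (fun n => Eventually.of_forall fun ξ => ?_) (Eventually.of_forall fun ξ => ?_)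
    · rw [norm_mul, norm_mul, Real.norm_eq_abs, Real.norm_eq_abs, Real.norm_eq_abs, Real.abs_exp]
      have h1 := Real.abs_cos_le_one (inner ℝ x ξ)
      have h2 := hC n (‖ξ‖ ^ 2) (by positivity)
      calc _ ≤ 1 * (C * Real.exp (-s * ‖ξ‖ ^ 2)) := by gcongr
        _ = _ := one_mul _
    · exact ((h _ (by positivity)).mul_const _).const_mul _

/-- The class is stable under multiplication by Laplace transforms of nonnegative functions. -/
theorem laplace_mul {f w : ℝ → ℝ} {a : ℝ} (ha : 0 ≤ a) (hf : GaussPos N f)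
    (hw : Measurable w) (hw0 : ∀ r, a < r → 0 ≤ w r) (hwi : IntegrableOn w (Ioi a)) :
    GaussPos N fun l => (∫ r in Ioi a, w r * Real.exp (-l * r)) * f l where
  meas := by
    have h : StronglyMeasurable (Function.uncurry fun l r : ℝ => w r * Real.exp (-l * r)) :=
      Measurable.stronglyMeasurable ((hw.comp measurable_snd).mul (by fun_prop))
    exact h.integral_prod_right.measurable.mul hf.meas
  bdd := by
    obtain ⟨C, hC⟩ := hf.bdd
    refine ⟨(∫ r in Ioi a, w r) * C, fun l hl => ?_⟩
    rw [abs_mul]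
    have hle : |∫ r in Ioi a, w r * Real.exp (-l * r)| ≤ ∫ r in Ioi a, w r := by
      rw [← Real.norm_eq_abs]
      refine norm_integral_le_of_norm_le hwi ?_
      filter_upwards [ae_restrict_mem measurableSet_Ioi] with r hr
      have hr' : a < r := hr
      rw [norm_mul, Real.norm_eq_abs, Real.norm_eq_abs, Real.abs_exp, abs_of_nonneg (hw0 r hr)]
      refine mul_le_of_le_one_right (hw0 r hr) (Real.exp_le_one_iff.2 ?_)
      nlinarith
    exact mul_le_mul hle (hC l hl) (abs_nonneg _) ((abs_nonneg _).trans hle)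
  radDec s hs := by
    obtain ⟨C, hC⟩ := hf.bdd
    let Φ : EuclideanSpace ℝ (Fin N) → EuclideanSpace ℝ (Fin N) → ℝ → ℝ := fun x ξ r =>
      w r * (Real.cos (inner ℝ x ξ) * (f (‖ξ‖ ^ 2) * Real.exp (-(s + r) * ‖ξ‖ ^ 2)))
    have hΦ : ∀ x, Integrable (Function.uncurry (Φ x))
        (volume.prod (volume.restrict (Ioi a))) := by
      intro x
      have hdom : Integrable
          (fun z : EuclideanSpace ℝ (Fin N) × ℝ => (C * Real.exp (-s * ‖z.1‖ ^ 2)) * w z.2)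
          (volume.prod (volume.restrict (Ioi a))) :=
        Integrable.mul_prod (f := fun ξ : EuclideanSpace ℝ (Fin N) =>
          C * Real.exp (-s * ‖ξ‖ ^ 2)) ((integrable_exp_neg_mul_norm_sq hs).const_mul C) hwi
      refine hdom.mono' ?_ ?_
      · have h1 : Measurable fun z : EuclideanSpace ℝ (Fin N) × ℝ => f (‖z.1‖ ^ 2) :=
          hf.meas.comp (by fun_prop)
        exact ((hw.comp measurable_snd).mul (Measurable.mul (by fun_prop)
          (h1.mul (by fun_prop)))).aestronglyMeasurable
      · have : ∀ᵐ z : EuclideanSpace ℝ (Fin N) × ℝ ∂volume.prod (volume.restrict (Ioi a)),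
            z.2 ∈ Ioi a :=
          Measure.quasiMeasurePreserving_snd.ae (ae_restrict_mem measurableSet_Ioi)
        filter_upwards [this] with z hz
        have hz' : a < z.2 := hz
        simp only [Function.uncurry, Φ]
        rw [norm_mul, norm_mul, norm_mul, Real.norm_eq_abs, Real.norm_eq_abs, Real.norm_eq_abs,
          Real.norm_eq_abs, Real.abs_exp, abs_of_nonneg (hw0 _ hz)]
        have h1 := Real.abs_cos_le_one (inner ℝ x z.1)
        have h2 := hC (‖z.1‖ ^ 2) (by positivity)
        have h3 : Real.exp (-(s + z.2) * ‖z.1‖ ^ 2) ≤ Real.exp (-s * ‖z.1‖ ^ 2) := by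
          apply Real.exp_le_exp.2
          nlinarith [sq_nonneg ‖z.1‖]
        have h4 := hw0 _ hz
        have hC0 : 0 ≤ C := (abs_nonneg _).trans h2
        calc _ ≤ w z.2 * (1 * (C * Real.exp (-s * ‖z.1‖ ^ 2))) := by gcongr
          _ = _ := by ring
    -- The factor exp(-lr) merges with exp(-sl) and only shifts s to s + r. After Fubini the
    -- transform is a mixture, with weights w ≥ 0, of transforms already known to be radially
    -- decreasing; this is why the class quantifies over all s > 0.
    have key : ∀ x, gaussFourier N (fun l => (∫ r in Ioi a, w r * Real.exp (-l * r)) * f l) s x =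
        ∫ r in Ioi a, w r * gaussFourier N f (s + r) x := by
      intro x
      have hsw := integral_integral_swap (hΦ x)
      have hl : ∀ ξ, ∫ r in Ioi a, Φ x ξ r = Real.cos (inner ℝ x ξ) *
          ((∫ r in Ioi a, w r * Real.exp (-‖ξ‖ ^ 2 * r)) * f (‖ξ‖ ^ 2) *
            Real.exp (-s * ‖ξ‖ ^ 2)) := by
        intro ξ
        rw [show Real.cos (inner ℝ x ξ) *
          ((∫ r in Ioi a, w r * Real.exp (-‖ξ‖ ^ 2 * r)) * f (‖ξ‖ ^ 2) *
            Real.exp (-s * ‖ξ‖ ^ 2)) = (Real.cos (inner ℝ x ξ) * f (‖ξ‖ ^ 2) *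
            Real.exp (-s * ‖ξ‖ ^ 2)) * ∫ r in Ioi a, w r * Real.exp (-‖ξ‖ ^ 2 * r) by ring,
          ← integral_const_mul]
        congr 1 with r
        simp only [Φ]
        rw [show -(s + r) * ‖ξ‖ ^ 2 = -s * ‖ξ‖ ^ 2 + -‖ξ‖ ^ 2 * r by ring, Real.exp_add]
        ring
      have hr : ∀ r, ∫ ξ, Φ x ξ r = w r * gaussFourier N f (s + r) x := by
        intro r
        rw [gaussFourier, ← integral_const_mul]
      simp only [hl, hr] at hsw
      exact hsw
    have hK : RadDec fun x => ∫ r in Ioi a, w r * gaussFourier N f (s + r) x := by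
      refine RadDec.integral ?_ fun x => ?_
      · filter_upwards [ae_restrict_mem measurableSet_Ioi] with r hr
        have hr' : a < r := hr
        exact (hf.radDec (s + r) (by linarith)).const_mul (hw0 r hr)
      · have := (hΦ x).integral_prod_right
        refine this.congr (Eventually.of_forall fun r => ?_)
        simp only [Function.uncurry, Φ]
        rw [gaussFourier, ← integral_const_mul]
    rwa [show gaussFourier N (fun l => (∫ r in Ioi a, w r * Real.exp (-l * r)) * f l) s = _ from
      funext key]

theorem laplace_pow {w : ℝ → ℝ} {a : ℝ} (ha : 0 ≤ a) (hw : Measurable w)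
    (hw0 : ∀ r, a < r → 0 ≤ w r) (hwi : IntegrableOn w (Ioi a)) (k : ℕ) :
    GaussPos N fun l => (∫ r in Ioi a, w r * Real.exp (-l * r)) ^ k := by
  induction k with
  | zero => simpa using one
  | succ k ih => simpa only [pow_succ'] using laplace_mul ha ih hw hw0 hwi

theorem sum {ι : Type*} (S : Finset ι) {f : ι → ℝ → ℝ} (hf : ∀ i, GaussPos N (f i)) :
    GaussPos N fun l => ∑ i ∈ S, f i l := by
  classical
  induction S using Finset.induction_on with
  | empty => simpa using (one (N := N)).const_mul le_rfl
  | insert i S hi ih => simpa only [Finset.sum_insert hi] using (hf i).add ih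

/-- The exponential series has nonnegative coefficients, so its partial sums stay in the class; they
are bounded by the exponential of a bound for the Laplace transform. -/
theorem exp_laplace {w : ℝ → ℝ} {a : ℝ} (ha : 0 ≤ a) (hw : Measurable w)
    (hw0 : ∀ r, a < r → 0 ≤ w r) (hwi : IntegrableOn w (Ioi a)) :
    GaussPos N fun l => Real.exp (∫ r in Ioi a, w r * Real.exp (-l * r)) := by
  have h1 := laplace_pow (N := N) ha hw hw0 hwi 1
  obtain ⟨C, hC⟩ := h1.bdd
  simp only [pow_one] at hC
  have hpos : ∀ l, 0 ≤ ∫ r in Ioi a, w r * Real.exp (-l * r) := fun l =>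
    setIntegral_nonneg measurableSet_Ioi fun r hr => mul_nonneg (hw0 r hr) (Real.exp_nonneg _)
  refine of_tendsto (C := Real.exp C)
    (f := fun n l => ∑ k ∈ Finset.range n,
      ((k.factorial : ℝ)⁻¹ * (∫ r in Ioi a, w r * Real.exp (-l * r)) ^ k))
    (fun n => sum _ fun k => (laplace_pow ha hw hw0 hwi k).const_mul (by positivity)) ?_ ?_ ?_
  · intro n l hl
    rw [abs_of_nonneg (Finset.sum_nonneg fun k _ =>
      mul_nonneg (by positivity) (pow_nonneg (hpos l) k))]
    refine le_trans ?_ (Real.exp_le_exp.2 ((le_abs_self _).trans (hC l hl)))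
    refine le_trans (le_of_eq ?_) (Real.sum_le_exp_of_nonneg (hpos l) n)
    exact Finset.sum_congr rfl fun k _ => by rw [div_eq_inv_mul]
  · simpa using h1.meas.exp
  · intro l hl
    have := (NormedSpace.expSeries_div_hasSum_exp (𝔸 := ℝ)
      (∫ r in Ioi a, w r * Real.exp (-l * r))).tendsto_sum_nat
    rw [← Real.exp_eq_exp_ℝ] at this
    simpa only [div_eq_inv_mul] using this

end GaussPos

/-! ### The fractional power as a Lévy-Khintchine integral -/

/-- Near 0 the bound 1 - exp(-lr) ≤ lr leaves r^(-β), integrable as β < 1; at infinity r^(-1-β)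
suffices as β > 0. -/
theorem integrableOn_one_sub_exp_mul_rpow {β : ℝ} (h0 : 0 < β) (h1 : β < 1) {l : ℝ} (hl : 0 ≤ l) :
    IntegrableOn (fun r : ℝ => (1 - Real.exp (-l * r)) * r ^ (-1 - β)) (Ioi 0) := by
  rw [← Ioc_union_Ioi_eq_Ioi (zero_le_one' ℝ)]
  have hm : ∀ S : Set ℝ, AEStronglyMeasurable
      (fun r : ℝ => (1 - Real.exp (-l * r)) * r ^ (-1 - β)) (volume.restrict S) := fun S =>
    (Measurable.mul (by fun_prop) (by fun_prop)).aestronglyMeasurable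
  have hb : ∀ r : ℝ, 0 < r → 0 ≤ 1 - Real.exp (-l * r) := fun r hr => by
    have : Real.exp (-l * r) ≤ 1 := Real.exp_le_one_iff.2 (by nlinarith)
    linarith
  refine IntegrableOn.union ?_ ?_
  · have hi : IntegrableOn (fun r : ℝ => l * r ^ (-β)) (Ioc 0 1) := by
      have := (intervalIntegral.intervalIntegrable_rpow' (a := 0) (b := 1) (r := -β)
        (by linarith)).const_mul l
      rwa [intervalIntegrable_iff_integrableOn_Ioc_of_le zero_le_one] at this
    refine Integrable.mono' hi (hm _) ?_
    filter_upwards [ae_restrict_mem measurableSet_Ioc] with r hr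
    have hr0 : 0 < r := hr.1
    rw [norm_mul, Real.norm_of_nonneg (hb r hr0), Real.norm_of_nonneg (by positivity)]
    have : 1 - Real.exp (-l * r) ≤ l * r := by linarith [Real.add_one_le_exp (-l * r)]
    calc _ ≤ (l * r) * r ^ (-1 - β) := by gcongr
      _ = l * (r ^ (1 : ℝ) * r ^ (-1 - β)) := by rw [Real.rpow_one]; ring
      _ = _ := by rw [← Real.rpow_add hr0]; ring_nf
  · have hi : IntegrableOn (fun r : ℝ => r ^ (-1 - β)) (Ioi 1) :=
      integrableOn_Ioi_rpow_of_lt (by linarith) one_pos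
    refine Integrable.mono' hi (hm _) ?_
    filter_upwards [ae_restrict_mem measurableSet_Ioi] with r hr
    have hr0 : 0 < r := lt_trans one_pos hr
    rw [norm_mul, Real.norm_of_nonneg (hb r hr0), Real.norm_of_nonneg (by positivity)]
    refine mul_le_of_le_one_left (by positivity) ?_
    linarith [Real.exp_pos (-l * r)]

/-- Substitution r ↦ lr. -/
theorem integral_one_sub_exp_mul_rpow {β : ℝ} (h0 : 0 < β) {l : ℝ} (hl : 0 ≤ l) :
    ∫ r in Ioi (0 : ℝ), (1 - Real.exp (-l * r)) * r ^ (-1 - β) =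
      l ^ β * ∫ r in Ioi (0 : ℝ), (1 - Real.exp (-r)) * r ^ (-1 - β) := by
  rcases hl.eq_or_lt with rfl | hl
  · simp [Real.zero_rpow h0.ne']
  have h := integral_comp_mul_left_Ioi (fun r => (1 - Real.exp (-r)) * r ^ (-1 - β)) 0 hl
  rw [mul_zero, smul_eq_mul] at h
  have h' : ∫ r in Ioi (0 : ℝ), (1 - Real.exp (-(l * r))) * (l * r) ^ (-1 - β) =
      l ^ (-1 - β) * ∫ r in Ioi (0 : ℝ), (1 - Real.exp (-l * r)) * r ^ (-1 - β) := by
    rw [← integral_const_mul]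
    refine setIntegral_congr_fun measurableSet_Ioi fun r hr => ?_
    have hr0 : (0 : ℝ) < r := hr
    rw [Real.mul_rpow hl.le hr0.le]
    ring_nf
  rw [h'] at h
  have e : l ^ (-1 - β) = l⁻¹ * (l ^ β)⁻¹ := by
    rw [Real.rpow_sub hl, Real.rpow_neg_one, div_eq_mul_inv]
  rw [e] at h
  have : 0 < l ^ β := Real.rpow_pos_of_pos hl β
  field_simp at h
  simpa only [neg_mul] using h

theorem integral_one_sub_exp_mul_rpow_pos {β : ℝ} (h0 : 0 < β) (h1 : β < 1) :
    0 < ∫ r in Ioi (0 : ℝ), (1 - Real.exp (-r)) * r ^ (-1 - β) := by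
  have hi := integrableOn_one_sub_exp_mul_rpow h0 h1 zero_le_one
  simp only [neg_mul, one_mul] at hi
  have hp : ∀ r ∈ Ioi (0 : ℝ), 0 < (1 - Real.exp (-r)) * r ^ (-1 - β) := fun r hr => by
    have hr0 : (0 : ℝ) < r := hr
    have : Real.exp (-r) < 1 := Real.exp_lt_one_iff.2 (by linarith)
    exact mul_pos (by linarith) (by positivity)
  rw [setIntegral_pos_iff_support_of_nonneg_ae _ hi]
  · have : Ioi (0 : ℝ) ⊆ Function.support (fun r : ℝ => (1 - Real.exp (-r)) * r ^ (-1 - β)) ∩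
        Ioi 0 := fun r hr => ⟨(hp r hr).ne', hr⟩
    refine lt_of_lt_of_le ?_ (measure_mono this)
    simp
  · filter_upwards [ae_restrict_mem measurableSet_Ioi] with r hr using (hp r hr).le

/-- The Lévy density r^(-1-β) is not integrable at 0, so it is cut off at r = 1/(n+1). The truncated
exponent then splits into a constant, giving a positive factor, plus a Laplace transform, to which
`exp_laplace` applies. Before splitting, the exponent is nonpositive, whence the uniform bound 1. -/
theorem gaussPos_exp_neg_rpow (N : ℕ) {β : ℝ} (h0 : 0 < β) (h1 : β < 1) {t : ℝ} (ht : 0 ≤ t) :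
    GaussPos N fun l => Real.exp (-t * l ^ β) := by
  set I := ∫ r in Ioi (0 : ℝ), (1 - Real.exp (-r)) * r ^ (-1 - β) with hI
  have hIpos : 0 < I := integral_one_sub_exp_mul_rpow_pos h0 h1
  let a : ℕ → ℝ := fun n => 1 / ((n : ℝ) + 1)
  have ha : ∀ n, 0 < a n := fun n => by positivity
  let w : ℝ → ℝ := fun r => t / I * r ^ (-1 - β)
  have hwm : Measurable w := by fun_prop
  have hw0 : ∀ n r, a n < r → 0 ≤ w r := fun n r hr => by
    have : 0 < r := (ha n).trans hr
    positivity
  have hwi : ∀ n, IntegrableOn w (Ioi (a n)) := fun n =>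
    (integrableOn_Ioi_rpow_of_lt (by linarith) (ha n)).const_mul _
  have hwe : ∀ n l, 0 ≤ l → IntegrableOn (fun r => w r * Real.exp (-l * r)) (Ioi (a n)) := by
    intro n l hl
    refine Integrable.mono' (hwi n) (hwm.mul (by fun_prop)).aestronglyMeasurable ?_
    filter_upwards [ae_restrict_mem measurableSet_Ioi] with r hr
    have hr0 : 0 < r := (ha n).trans hr
    rw [norm_mul, Real.norm_of_nonneg (hw0 n r hr), Real.norm_of_nonneg (Real.exp_nonneg _)]
    exact mul_le_of_le_one_right (hw0 n r hr) (Real.exp_le_one_iff.2 (by nlinarith))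
  have hdiff : ∀ n l, 0 ≤ l → -(∫ r in Ioi (a n), w r) + ∫ r in Ioi (a n), w r * Real.exp (-l * r)
      = -(t / I * ∫ r in Ioi (a n), (1 - Real.exp (-l * r)) * r ^ (-1 - β)) := by
    intro n l hl
    have : t / I * ∫ r in Ioi (a n), (1 - Real.exp (-l * r)) * r ^ (-1 - β) =
        (∫ r in Ioi (a n), w r) - ∫ r in Ioi (a n), w r * Real.exp (-l * r) := by
      rw [← integral_sub (hwi n) (hwe n l hl), ← integral_const_mul]
      congr 1 with r
      simp only [w]
      ring
    rw [this]
    ring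
  refine GaussPos.of_tendsto (C := 1) (f := fun n l =>
    Real.exp (-∫ r in Ioi (a n), w r) * Real.exp (∫ r in Ioi (a n), w r * Real.exp (-l * r)))
    (fun n => (GaussPos.exp_laplace (ha n).le hwm (hw0 n) (hwi n)).const_mul (Real.exp_nonneg _))
    ?_ (by fun_prop) ?_
  · intro n l hl
    rw [← Real.exp_add, Real.abs_exp, hdiff n l hl, Real.exp_le_one_iff]
    refine neg_nonpos.2 (mul_nonneg (by positivity)
      (setIntegral_nonneg measurableSet_Ioi fun r hr => ?_))
    have hr0 : 0 < r := (ha n).trans hr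
    have : Real.exp (-l * r) ≤ 1 := Real.exp_le_one_iff.2 (by nlinarith)
    exact mul_nonneg (by linarith) (by positivity)
  · intro l hl
    simp only [← Real.exp_add, hdiff _ l hl]
    refine (Real.continuous_exp.tendsto _).comp ?_
    have hU : ⋃ n, Ioi (a n) = Ioi 0 := by
      ext r
      simp only [mem_iUnion, mem_Ioi]
      exact ⟨fun ⟨n, hn⟩ => (ha n).trans hn, fun hr => exists_nat_one_div_lt hr⟩
    have hmono : Monotone fun n => Ioi (a n) := fun m n hmn =>
      Ioi_subset_Ioi (Nat.one_div_le_one_div hmn)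
    have hlim := tendsto_setIntegral_of_monotone (μ := volume) (fun n => measurableSet_Ioi) hmono
      (by rw [hU]; exact integrableOn_one_sub_exp_mul_rpow h0 h1 hl)
    rw [hU, integral_one_sub_exp_mul_rpow h0 hl] at hlim
    have := (hlim.const_mul (t / I)).neg
    convert this using 2
    rw [← hI]
    field_simp

/-! ### The fundamental solution is nonnegative and radially decreasing -/

theorem integrable_exp_neg_norm_rpow {N : ℕ} (hN : 1 ≤ N) {θ t : ℝ} (hθ : 0 < θ) (ht : 0 < t) :
    Integrable fun ξ : EuclideanSpace ℝ (Fin N) => Real.exp (-t * ‖ξ‖ ^ θ) := by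
  have : Nonempty (Fin N) := ⟨⟨0, hN⟩⟩
  have : Nontrivial (EuclideanSpace ℝ (Fin N)) := inferInstance
  refine (integrable_fun_norm_addHaar (μ := (volume : Measure (EuclideanSpace ℝ (Fin N))))
    (f := fun r => Real.exp (-t * r ^ θ))).2 ?_
  have := integrableOn_rpow_mul_exp_neg_mul_rpow (p := θ) (s := ((N - 1 : ℕ) : ℝ)) (b := t)
    (by have : (0 : ℝ) ≤ ((N - 1 : ℕ) : ℝ) := by positivity
        linarith) hθ ht
  simpa using this

/-- Let the Gaussian regularisation s tend to 0; the symbol itself dominates. -/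
theorem fundSol_radDec {N : ℕ} (hN : 1 ≤ N) {θ t : ℝ} (hθ : 0 < θ) (hθ2 : θ ≤ 2) (ht : 0 < t) :
    RadDec fun x : EuclideanSpace ℝ (Fin N) => fundSol θ x t := by
  refine RadDec.const_mul ?_ (by positivity)
  have hs : ∀ s, 0 < s → RadDec (gaussFourier N (fun l => Real.exp (-t * l ^ (θ / 2))) s) := by
    intro s hs
    -- The Lévy integral needs β = θ/2 < 1; for θ = 2 the symbol is itself Gaussian.
    rcases hθ2.eq_or_lt with rfl | h2
    · have := (GaussPos.one (N := N)).radDec (t + s) (by linarith)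
      have e : gaussFourier N (fun l => Real.exp (-t * l ^ ((2 : ℝ) / 2))) s =
          gaussFourier N (fun _ => 1) (t + s) := by
        funext x
        unfold gaussFourier
        congr 1 with ξ
        rw [← Real.exp_add]
        norm_num
        left
        ring
      rwa [e]
    · exact (gaussPos_exp_neg_rpow N (by linarith) (by linarith) ht.le).radDec s hs
  refine RadDec.of_tendsto (l := 𝓝[>] (0 : ℝ)) (eventually_mem_nhdsWithin.mono hs) fun x => ?_
  refine tendsto_integral_filter_of_dominated_convergence
    (fun ξ : EuclideanSpace ℝ (Fin N) => Real.exp (-t * ‖ξ‖ ^ θ)) ?_ ?_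
    (integrable_exp_neg_norm_rpow hN hθ ht) ?_
  · exact Eventually.of_forall fun s => Measurable.aestronglyMeasurable (by fun_prop)
  · filter_upwards [self_mem_nhdsWithin] with s hs
    refine Eventually.of_forall fun ξ => ?_
    have hs0 : 0 < s := hs
    rw [norm_mul, norm_mul, Real.norm_eq_abs, Real.norm_eq_abs, Real.norm_eq_abs, Real.abs_exp,
      Real.abs_exp, ← Real.rpow_natCast, ← Real.rpow_mul (norm_nonneg _)]
    have h1 := Real.abs_cos_le_one (inner ℝ x ξ)
    have h2 : Real.exp (-s * ‖ξ‖ ^ ((2 : ℕ) : ℝ)) ≤ 1 := Real.exp_le_one_iff.2 (by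
      have : 0 ≤ ‖ξ‖ ^ ((2 : ℕ) : ℝ) := by positivity
      nlinarith)
    calc _ ≤ 1 * (Real.exp (-t * ‖ξ‖ ^ (((2 : ℕ) : ℝ) * (θ / 2))) * 1) := by gcongr
      _ = _ := by rw [one_mul, mul_one]; congr 3; push_cast; ring
  · refine Eventually.of_forall fun ξ => ?_
    have : Tendsto (fun s : ℝ => Real.cos (inner ℝ x ξ) *
        (Real.exp (-t * (‖ξ‖ ^ 2) ^ (θ / 2)) * Real.exp (-s * ‖ξ‖ ^ 2))) (𝓝[>] 0)
        (𝓝 (Real.cos (inner ℝ x ξ) *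
        (Real.exp (-t * (‖ξ‖ ^ 2) ^ (θ / 2)) * Real.exp (-0 * ‖ξ‖ ^ 2)))) := by
      refine tendsto_nhdsWithin_of_tendsto_nhds (Continuous.tendsto ?_ 0)
      fun_prop
    convert this using 3
    rw [← Real.rpow_natCast, ← Real.rpow_mul (norm_nonneg _)]
    simp [mul_div_cancel₀]

/-! ### Fourier analysis of the fundamental solution -/

/-- The Fourier symbol `exp (-t |ξ|^θ)`, as a complex function. -/
noncomputable def symbol (N : ℕ) (θ t : ℝ) (ξ : EuclideanSpace ℝ (Fin N)) : ℂ :=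
  (Real.exp (-t * ‖ξ‖ ^ θ) : ℝ)

open scoped FourierTransform

section Fourier

variable {N : ℕ} {θ s t : ℝ}

theorem symbol_add (ξ : EuclideanSpace ℝ (Fin N)) :
    symbol N θ (t + s) ξ = symbol N θ t ξ * symbol N θ s ξ := by
  simp only [symbol]
  rw [← Complex.ofReal_mul, ← Real.exp_add]
  congr 2
  ring

theorem continuous_symbol (hθ : 0 < θ) : Continuous (symbol N θ t) := by
  unfold symbol
  have : Continuous fun ξ : EuclideanSpace ℝ (Fin N) => ‖ξ‖ ^ θ :=
    continuous_norm.rpow_const fun _ => Or.inr hθ.le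
  fun_prop

theorem integrable_symbol (hN : 1 ≤ N) (hθ : 0 < θ) (ht : 0 < t) : Integrable (symbol N θ t) :=
  (integrable_exp_neg_norm_rpow hN hθ ht).ofReal

theorem fundSol_neg (x : EuclideanSpace ℝ (Fin N)) : fundSol θ (-x) t = fundSol θ x t := by
  simp [fundSol]

theorem integral_sin_mul_exp (x : EuclideanSpace ℝ (Fin N)) :
    ∫ ξ : EuclideanSpace ℝ (Fin N), Real.sin (inner ℝ x ξ) * Real.exp (-t * ‖ξ‖ ^ θ) = 0 := by
  have h := integral_neg_eq_self (fun ξ : EuclideanSpace ℝ (Fin N) =>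
    Real.sin (inner ℝ x ξ) * Real.exp (-t * ‖ξ‖ ^ θ)) volume
  simp only [inner_neg_right, Real.sin_neg, norm_neg, neg_mul, integral_neg] at h
  simp only [neg_mul]
  linarith

theorem fourier_symbol (hN : 1 ≤ N) (hθ : 0 < θ) (ht : 0 < t) (w : EuclideanSpace ℝ (Fin N)) :
    𝓕 (symbol N θ t) w = ((2 * Real.pi) ^ N * fundSol θ ((2 * Real.pi) • w) t : ℝ) := by
  have hint : Integrable fun v : EuclideanSpace ℝ (Fin N) =>
      Complex.exp ((↑(-2 * Real.pi * inner ℝ v w) * Complex.I)) • symbol N θ t v := by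
    refine (integrable_symbol hN hθ ht).mono
      (Continuous.aestronglyMeasurable ?_) (Eventually.of_forall fun v => ?_)
    · have := continuous_symbol (N := N) (t := t) hθ
      fun_prop
    · rw [norm_smul, Complex.norm_exp_ofReal_mul_I, one_mul]
  have e : ∀ v : EuclideanSpace ℝ (Fin N),
      Complex.exp ((↑(-2 * Real.pi * inner ℝ v w) * Complex.I)) • symbol N θ t v =
      ((Real.cos (inner ℝ ((2 * Real.pi) • w) v) * Real.exp (-t * ‖v‖ ^ θ) : ℝ) : ℂ) -
      ((Real.sin (inner ℝ ((2 * Real.pi) • w) v) * Real.exp (-t * ‖v‖ ^ θ) : ℝ) : ℂ) *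
        Complex.I := by
    intro v
    rw [inner_smul_left, real_inner_comm, Complex.exp_mul_I, ← Complex.ofReal_cos,
      ← Complex.ofReal_sin,
      show -2 * Real.pi * inner ℝ w v = -((2 * Real.pi) * inner ℝ w v) by ring,
      Real.cos_neg, Real.sin_neg, smul_eq_mul, symbol]
    push_cast
    simp
    ring
  rw [Real.fourier_eq']
  simp only [e] at hint ⊢
  apply Complex.ext
  · have h := integral_re (𝕜 := ℂ) hint
    simp only [RCLike.re_eq_complex_re] at h
    rw [← h, Complex.ofReal_re, fundSol, mul_inv_cancel_left₀ (by positivity)]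
    congr 1 with v
    rw [Complex.sub_re, Complex.re_ofReal_mul, Complex.I_re, Complex.ofReal_re]
    ring
  · have h := integral_im (𝕜 := ℂ) hint
    simp only [RCLike.im_eq_complex_im] at h
    rw [← h, Complex.ofReal_im, ← neg_eq_zero, ← integral_neg,
      ← integral_sin_mul_exp (θ := θ) (t := t) ((2 * Real.pi) • w)]
    congr 1 with v
    rw [Complex.sub_im, Complex.im_ofReal_mul, Complex.I_im, Complex.ofReal_im]
    ring

/-- A nonnegative transform of an integrable function continuous at 0 is integrable: its Gaussian
means converge to the value of the symbol at 0, which is 1, and Fatou's lemma bounds the full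
integral by 1. -/
theorem integrable_fourier_symbol (hN : 1 ≤ N) (hθ : 0 < θ) (hθ2 : θ ≤ 2) (ht : 0 < t) :
    Integrable (𝓕 (symbol N θ t)) := by
  have hf := integrable_symbol hN hθ ht
  set K : EuclideanSpace ℝ (Fin N) → ℝ :=
    fun w => (2 * Real.pi) ^ N * fundSol θ ((2 * Real.pi) • w) t with hK
  have hFK : 𝓕 (symbol N θ t) = fun w => (K w : ℂ) := funext fun w => fourier_symbol hN hθ ht w
  have hK0 : ∀ w, 0 ≤ K w := fun w =>
    mul_nonneg (by positivity) ((fundSol_radDec hN hθ hθ2 ht).nonneg _)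
  have hcont : Continuous (𝓕 (symbol N θ t)) :=
    VectorFourier.fourierIntegral_continuous Real.continuous_fourierChar
      (innerSL ℝ).continuous₂ hf
  have hKc : Continuous K := by
    have := Complex.continuous_re.comp hcont
    rw [hFK] at this
    exact this
  have hKb : ∀ w, ‖𝓕 (symbol N θ t) w‖ ≤ ∫ v, ‖symbol N θ t v‖ := fun w =>
    VectorFourier.norm_fourierIntegral_le_integral_norm _ _ _ _ _
  let g : ℝ → EuclideanSpace ℝ (Fin N) → ℝ := fun c w => Real.exp (-c⁻¹ * ‖w‖ ^ 2) * K w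
  have hgi : ∀ c, 0 < c → Integrable (g c) := by
    intro c hc
    refine ((integrable_exp_neg_mul_norm_sq (N := N) (inv_pos.2 hc)).mul_const
      (∫ v, ‖symbol N θ t v‖)).mono' (by fun_prop) (Eventually.of_forall fun w => ?_)
    rw [norm_mul, Real.norm_of_nonneg (Real.exp_nonneg _)]
    refine mul_le_mul_of_nonneg_left ?_ (Real.exp_nonneg _)
    have := hKb w
    rw [hFK] at this
    simpa using this
  have h1 := Real.tendsto_integral_gaussian_smul' hf (v := 0)
    (continuous_symbol (N := N) (t := t) hθ).continuousAt
  have hlim : Tendsto (fun c => ∫ w, g c w) atTop (𝓝 1) := by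
    have h2 : Tendsto (fun c : ℝ => ((∫ w, g c w : ℝ) : ℂ)) atTop (𝓝 (symbol N θ t 0)) := by
      refine h1.congr' ?_
      filter_upwards [Ioi_mem_atTop 0] with c (hc : 0 < c)
      have hcc : 0 < ((c⁻¹ : ℝ) : ℂ).re := by simpa using hc
      have J : Integrable fun w : EuclideanSpace ℝ (Fin N) =>
          Complex.exp (-((c⁻¹ : ℝ) : ℂ) * ‖w‖ ^ 2) := by
        simpa using GaussianFourier.integrable_cexp_neg_mul_sq_norm_add hcc 0
          (0 : EuclideanSpace ℝ (Fin N))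
      -- Moving the transform onto the Gaussian turns the Gaussian mean into an approximate identity
      -- at 0 tested on the symbol, whose limit is `h1`.
      have hflip : ∫ w, 𝓕 (fun w : EuclideanSpace ℝ (Fin N) =>
          Complex.exp (-((c⁻¹ : ℝ) : ℂ) * ‖w‖ ^ 2)) w • symbol N θ t w =
          ∫ w, Complex.exp (-((c⁻¹ : ℝ) : ℂ) * ‖w‖ ^ 2) • 𝓕 (symbol N θ t) w := by
        simpa using! (VectorFourier.integral_fourierIntegral_smul_eq_flip
          (L := innerₗ (EuclideanSpace ℝ (Fin N)))
          Real.continuous_fourierChar continuous_inner J hf)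
      have e1 : ∫ w, Complex.exp (-((c⁻¹ : ℝ) : ℂ) * ‖w‖ ^ 2) • 𝓕 (symbol N θ t) w =
          ((∫ w, g c w : ℝ) : ℂ) := by
        rw [← integral_complex_ofReal]
        congr 1 with w
        rw [fourier_symbol hN hθ ht]
        simp only [g, hK]
        push_cast
        rw [smul_eq_mul]
      rw [← e1, ← hflip]
      congr 1 with w
      rw [fourier_gaussian_innerProductSpace hcc]
      congr 2
      · congr 1
        push_cast
        rw [div_inv_eq_mul]
      · congr 1
        push_cast
        rw [zero_sub, norm_neg, div_inv_eq_mul]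
        ring
    have h3 := (Complex.continuous_re.tendsto _).comp h2
    have e0 : (symbol N θ t 0).re = 1 := by simp [symbol, Real.zero_rpow hθ.ne']
    rw [e0] at h3
    exact h3
  have hfatou : ∫⁻ w, ENNReal.ofReal (K w) ≤ 1 := by
    have hpt : ∀ w, liminf (fun c => ENNReal.ofReal (g c w)) atTop = ENNReal.ofReal (K w) := by
      intro w
      refine Tendsto.liminf_eq (ENNReal.tendsto_ofReal ?_)
      have : Tendsto (fun c : ℝ => Real.exp (-c⁻¹ * ‖w‖ ^ 2) * K w) atTop
          (𝓝 (Real.exp (-0 * ‖w‖ ^ 2) * K w)) :=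
        (((Real.continuous_exp.tendsto _).comp
          ((tendsto_inv_atTop_zero.neg).mul_const _))).mul_const _
      simpa [g] using this
    calc ∫⁻ w, ENNReal.ofReal (K w)
        = ∫⁻ w, liminf (fun c => ENNReal.ofReal (g c w)) atTop := by simp only [hpt]
      _ ≤ liminf (fun c => ∫⁻ w, ENNReal.ofReal (g c w)) atTop :=
          lintegral_liminf_le fun c => by fun_prop
      _ = 1 := by
          refine Tendsto.liminf_eq ?_
          have := ENNReal.tendsto_ofReal hlim
          rw [ENNReal.ofReal_one] at this
          refine this.congr' ?_
          filter_upwards [Ioi_mem_atTop 0] with c (hc : 0 < c)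
          exact ofReal_integral_eq_lintegral_ofReal (hgi c hc)
            (Eventually.of_forall fun w => mul_nonneg (Real.exp_nonneg _) (hK0 w))
  rw [hFK]
  have hKi : Integrable K := by
    refine ⟨hKc.aestronglyMeasurable, ?_⟩
    rw [hasFiniteIntegral_iff_ofReal (Eventually.of_forall hK0)]
    exact hfatou.trans_lt ENNReal.one_lt_top
  exact hKi.ofReal

/-- Fourier inversion; the reflection is absorbed since the symbol is even. -/
theorem fourier_fourier_symbol (hN : 1 ≤ N) (hθ : 0 < θ) (hθ2 : θ ≤ 2) (ht : 0 < t)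
    (ξ : EuclideanSpace ℝ (Fin N)) : 𝓕 (𝓕 (symbol N θ t)) ξ = symbol N θ t ξ := by
  have h := (continuous_symbol (N := N) (t := t) hθ).fourierInv_fourier_eq
    (integrable_symbol hN hθ ht) (integrable_fourier_symbol hN hθ hθ2 ht)
  have h' := congrFun h (-ξ)
  rw [Real.fourierInv_eq_fourier_neg, neg_neg] at h'
  rw [h']
  simp [symbol]

theorem continuous_fundSol (hN : 1 ≤ N) (hθ : 0 < θ) (ht : 0 < t) :
    Continuous fun x : EuclideanSpace ℝ (Fin N) => fundSol θ x t := by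
  have hcont : Continuous (𝓕 (symbol N θ t)) :=
    VectorFourier.fourierIntegral_continuous Real.continuous_fourierChar
      (innerSL ℝ).continuous₂ (integrable_symbol hN hθ ht)
  have h : (fun x : EuclideanSpace ℝ (Fin N) => fundSol θ x t) =
      fun x => ((2 * Real.pi) ^ N)⁻¹ * (𝓕 (symbol N θ t) ((2 * Real.pi)⁻¹ • x)).re := by
    funext x
    rw [fourier_symbol hN hθ ht, Complex.ofReal_re, smul_inv_smul₀ (by positivity),
      inv_mul_cancel_left₀ (by positivity)]
  rw [h]
  fun_prop

theorem integrable_fundSol (hN : 1 ≤ N) (hθ : 0 < θ) (hθ2 : θ ≤ 2) (ht : 0 < t) :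
    Integrable fun x : EuclideanSpace ℝ (Fin N) => fundSol θ x t := by
  have h := (integrable_fourier_symbol hN hθ hθ2 ht).re
  have e : (fun w => RCLike.re (𝓕 (symbol N θ t) w)) =
      fun w : EuclideanSpace ℝ (Fin N) =>
        (2 * Real.pi) ^ N * fundSol θ ((2 * Real.pi) • w) t := by
    funext w
    rw [fourier_symbol hN hθ ht]
    exact Complex.ofReal_re _
  rw [e] at h
  have h2 := h.const_mul (((2 * Real.pi) ^ N)⁻¹)
  simp only [inv_mul_cancel_left₀ (show ((2 * Real.pi) ^ N : ℝ) ≠ 0 by positivity)] at h2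
  exact (integrable_comp_smul_iff volume (fun x : EuclideanSpace ℝ (Fin N) => fundSol θ x t)
    (show (2 * Real.pi : ℝ) ≠ 0 by positivity)).1 h2

/-- Inversion evaluated at frequency 0; the factors of 2π cancel in the change of variables. -/
theorem integral_fundSol (hN : 1 ≤ N) (hθ : 0 < θ) (hθ2 : θ ≤ 2) (ht : 0 < t) :
    ∫ x : EuclideanSpace ℝ (Fin N), fundSol θ x t = 1 := by
  have h := fourier_fourier_symbol hN hθ hθ2 ht 0
  rw [Real.fourier_eq'] at h
  simp only [inner_zero_right, mul_zero, Complex.ofReal_zero, zero_mul, Complex.exp_zero,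
    one_smul, fourier_symbol hN hθ ht] at h
  rw [integral_complex_ofReal, symbol, Complex.ofReal_inj, integral_const_mul,
    Measure.integral_comp_smul volume
      (fun x : EuclideanSpace ℝ (Fin N) => fundSol θ x t)] at h
  simp only [finrank_euclideanSpace, Fintype.card_fin, smul_eq_mul, norm_zero,
    Real.zero_rpow hθ.ne', mul_zero, Real.exp_zero] at h
  rwa [abs_of_nonneg (by positivity), mul_inv_cancel_left₀ (by positivity)] at h

theorem lintegral_fundSol (hN : 1 ≤ N) (hθ : 0 < θ) (hθ2 : θ ≤ 2) (ht : 0 < t)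
    (x : EuclideanSpace ℝ (Fin N)) :
    ∫⁻ y : EuclideanSpace ℝ (Fin N), ENNReal.ofReal (fundSol θ (x - y) t) = 1 := by
  rw [lintegral_sub_left_eq_self (fun y => ENNReal.ofReal (fundSol θ y t)) x,
    ← ofReal_integral_eq_lintegral_ofReal (integrable_fundSol hN hθ hθ2 ht)
      (Eventually.of_forall (fundSol_radDec hN hθ hθ2 ht).nonneg),
    integral_fundSol hN hθ hθ2 ht, ENNReal.ofReal_one]

theorem fundSol_le_zero (hN : 1 ≤ N) (hθ : 0 < θ) (hθ2 : θ ≤ 2) (ht : 0 < t)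
    (x : EuclideanSpace ℝ (Fin N)) : fundSol θ x t ≤
    fundSol θ (0 : EuclideanSpace ℝ (Fin N)) t :=
  (fundSol_radDec hN hθ hθ2 ht).anti 0 x (by simp)

theorem integrable_fundSol_mul (hN : 1 ≤ N) (hθ : 0 < θ) (hθ2 : θ ≤ 2) (ht : 0 < t) (hs : 0 < s)
    (x : EuclideanSpace ℝ (Fin N)) :
    Integrable fun y => fundSol θ (x - y) t * fundSol θ y s := by
  have hc : Continuous fun y => fundSol θ (x - y) t :=
    (continuous_fundSol hN hθ ht).comp (continuous_const.sub continuous_id)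
  refine (integrable_fundSol hN hθ hθ2 hs).bdd_mul (c := fundSol θ (0 : EuclideanSpace ℝ (Fin N)) t)
    hc.aestronglyMeasurable (Eventually.of_forall fun y => ?_)
  rw [Real.norm_of_nonneg ((fundSol_radDec hN hθ hθ2 ht).nonneg _)]
  exact fundSol_le_zero hN hθ hθ2 ht _

/-- Symbols multiply, so kernels convolve. Modulating the symbol at time t translates its transform;
the self-adjointness of 𝓕 then moves the second transform across, where inversion removes it. -/
theorem integral_fundSol_mul (hN : 1 ≤ N) (hθ : 0 < θ) (hθ2 : θ ≤ 2) (ht : 0 < t) (hs : 0 < s)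
    (x : EuclideanSpace ℝ (Fin N)) :
    ∫ y, fundSol θ (x - y) t * fundSol θ y s = fundSol θ x (t + s) := by
  set w : EuclideanSpace ℝ (Fin N) := (2 * Real.pi)⁻¹ • x with hw
  have hx : x = (2 * Real.pi) • w := by rw [hw, smul_inv_smul₀ (by positivity)]
  let f : EuclideanSpace ℝ (Fin N) → ℂ := fun ξ =>
    Complex.exp (↑(2 * Real.pi * inner ℝ ξ w) * Complex.I) • symbol N θ t ξ
  have hf : Integrable f := by
    refine (integrable_symbol hN hθ ht).mono
      (Continuous.aestronglyMeasurable ?_) (Eventually.of_forall fun v => ?_)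
    · have := continuous_symbol (N := N) (t := t) hθ
      fun_prop
    · simp only [f]
      rw [norm_smul, Complex.norm_exp_ofReal_mul_I, one_mul]
  have hg := integrable_fourier_symbol hN hθ hθ2 hs
  have hflip : ∫ v, 𝓕 f v • 𝓕 (symbol N θ s) v = ∫ ξ, f ξ • 𝓕 (𝓕 (symbol N θ s)) ξ := by
    simpa using! (VectorFourier.integral_fourierIntegral_smul_eq_flip
      (L := innerₗ (EuclideanSpace ℝ (Fin N)))
      Real.continuous_fourierChar continuous_inner hf hg)
  have hFf : ∀ v, 𝓕 f v = ((2 * Real.pi) ^ N * fundSol θ ((2 * Real.pi) • (w - v)) t : ℝ) := by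
    intro v
    rw [← fundSol_neg, ← smul_neg, neg_sub, ← fourier_symbol hN hθ ht, Real.fourier_eq',
      Real.fourier_eq']
    congr 1 with ξ
    simp only [f]
    rw [smul_smul, ← Complex.exp_add, inner_sub_right]
    congr 2
    push_cast
    ring
  have hR : ∫ ξ, f ξ • 𝓕 (𝓕 (symbol N θ s)) ξ = 𝓕 (symbol N θ (t + s)) (-w) := by
    rw [Real.fourier_eq']
    congr 1 with ξ
    rw [fourier_fourier_symbol hN hθ hθ2 hs, symbol_add]
    simp only [f, inner_neg_right, smul_eq_mul]
    rw [← mul_assoc]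
    congr 3
    push_cast
    ring
  rw [hR, fourier_symbol hN hθ (add_pos ht hs)] at hflip
  simp only [hFf, fourier_symbol hN hθ hs, smul_eq_mul, ← Complex.ofReal_mul] at hflip
  rw [integral_complex_ofReal, Complex.ofReal_inj, smul_neg, fundSol_neg, ← hx] at hflip
  have e : ∀ v, (2 * Real.pi) ^ N * fundSol θ ((2 * Real.pi) • (w - v)) t *
      ((2 * Real.pi) ^ N * fundSol θ ((2 * Real.pi) • v) s) =
      (2 * Real.pi) ^ N * ((2 * Real.pi) ^ N * (fun y => fundSol θ (x - y) t * fundSol θ y s)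
        ((2 * Real.pi) • v)) := by
    intro v
    simp only
    rw [smul_sub, ← hx]
    ring
  simp only [e] at hflip
  rw [integral_const_mul, integral_const_mul, Measure.integral_comp_smul volume
      (fun y : EuclideanSpace ℝ (Fin N) => fundSol θ (x - y) t * fundSol θ y s)] at hflip
  have h2 := mul_left_cancel₀ (show ((2 * Real.pi) ^ N : ℝ) ≠ 0 by positivity) hflip
  simp only [finrank_euclideanSpace, Fintype.card_fin, smul_eq_mul] at h2
  rwa [abs_of_nonneg (by positivity), mul_inv_cancel_left₀ (by positivity)] at h2

/-- Self-similarity, needed only at the origin. -/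
theorem fundSol_zero (ht : 0 < t) (hθ : 0 < θ) :
    fundSol θ (0 : EuclideanSpace ℝ (Fin N)) t =
      ((t ^ (1 / θ)) ^ N)⁻¹ * fundSol θ (0 : EuclideanSpace ℝ (Fin N)) 1 := by
  have h := Measure.integral_comp_smul volume
    (fun ξ : EuclideanSpace ℝ (Fin N) => Real.exp (-1 * ‖ξ‖ ^ θ)) (t ^ (1 / θ))
  have e : ∀ ξ : EuclideanSpace ℝ (Fin N), Real.exp (-1 * ‖(t ^ (1 / θ)) • ξ‖ ^ θ) =
      Real.exp (-t * ‖ξ‖ ^ θ) := by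
    intro ξ
    rw [norm_smul, Real.norm_of_nonneg (by positivity),
      Real.mul_rpow (by positivity) (norm_nonneg _), ← Real.rpow_mul ht.le,
      one_div_mul_cancel hθ.ne', Real.rpow_one]
    congr 1
    ring
  simp only [e, finrank_euclideanSpace, Fintype.card_fin, smul_eq_mul] at h
  rw [abs_of_nonneg (by positivity)] at h
  simp only [fundSol, inner_zero_left, Real.cos_zero, one_mul]
  rw [h]
  ring

theorem lintegral_fundSol_mul (hN : 1 ≤ N) (hθ : 0 < θ) (hθ2 : θ ≤ 2) (ht : 0 < t) (hs : 0 < s)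
    (x z : EuclideanSpace ℝ (Fin N)) :
    ∫⁻ y, ENNReal.ofReal (fundSol θ (x - y) t) * ENNReal.ofReal (fundSol θ (y - z) s) =
      ENNReal.ofReal (fundSol θ (x - z) (t + s)) := by
  have h0 := (fundSol_radDec hN hθ hθ2 ht).nonneg
  have h1 := (fundSol_radDec hN hθ hθ2 hs).nonneg
  rw [← integral_fundSol_mul hN hθ hθ2 ht hs,
    ofReal_integral_eq_lintegral_ofReal (integrable_fundSol_mul hN hθ hθ2 ht hs _)
      (Eventually.of_forall fun y => mul_nonneg (h0 _) (h1 _)),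
    ← lintegral_sub_right_eq_self
      (fun y => ENNReal.ofReal (fundSol θ (x - z - y) t * fundSol θ y s)) z]
  congr 1 with y
  rw [← ENNReal.ofReal_mul (h0 _), sub_sub_sub_cancel_right]

theorem measurable_fundSol :
    Measurable fun z : EuclideanSpace ℝ (Fin N) × ℝ => fundSol θ z.1 z.2 := by
  unfold fundSol
  refine Measurable.const_mul ?_ _
  have h : StronglyMeasurable (Function.uncurry
      fun (z : EuclideanSpace ℝ (Fin N) × ℝ) (ξ : EuclideanSpace ℝ (Fin N)) =>
        Real.cos (inner ℝ z.1 ξ) * Real.exp (-z.2 * ‖ξ‖ ^ θ)) := by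
    refine Measurable.stronglyMeasurable ?_
    unfold Function.uncurry
    fun_prop
  exact h.integral_prod_right.measurable

end Fourier

/-! ### The semigroup on nonnegative functions -/

/-- `∫ Γ_θ(x - y, t) f(y) dy` for a `[0, ∞]`-valued function `f`. -/
noncomputable def heat {N : ℕ} (θ t : ℝ) (f : EuclideanSpace ℝ (Fin N) → ℝ≥0∞)
    (x : EuclideanSpace ℝ (Fin N)) : ℝ≥0∞ :=
  ∫⁻ y, ENNReal.ofReal (fundSol θ (x - y) t) * f y

theorem lintegral_rpow_le_lintegral_rpow {Ω : Type*} [MeasurableSpace Ω] {ρ : Measure Ω}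
    [IsProbabilityMeasure ρ] {f : Ω → ℝ≥0∞} (hf : AEMeasurable f ρ) {p q : ℝ} (hp : 0 < p)
    (hpq : p ≤ q) : (∫⁻ a, f a ^ p ∂ρ) ^ (1 / p) ≤ (∫⁻ a, f a ^ q ∂ρ) ^ (1 / q) := by
  have := eLpNorm'_le_eLpNorm'_of_exponent_le hp hpq ρ hf.aestronglyMeasurable
  simpa [eLpNorm'] using this

section Heat

variable {N : ℕ} {θ s t : ℝ}

theorem measurable_ofReal_fundSol_sub (x : EuclideanSpace ℝ (Fin N)) (t : ℝ) :
    Measurable fun y => ENNReal.ofReal (fundSol θ (x - y) t) :=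
  ENNReal.measurable_ofReal.comp (measurable_fundSol.comp
    (f := fun y => (x - y, t)) (by fun_prop))

theorem semigroup_withDensity {f : EuclideanSpace ℝ (Fin N) → ℝ≥0∞} (hf : Measurable f)
    (t : ℝ) (x : EuclideanSpace ℝ (Fin N)) :
    semigroup θ t (volume.withDensity f) x = heat θ t f x := by
  rw [semigroup, heat, lintegral_withDensity_eq_lintegral_mul _ hf
    (measurable_ofReal_fundSol_sub x t)]
  simp only [Pi.mul_apply, mul_comm]

theorem heat_mono {f g : EuclideanSpace ℝ (Fin N) → ℝ≥0∞} (h : ∀ y, f y ≤ g y)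
    (x : EuclideanSpace ℝ (Fin N)) : heat θ t f x ≤ heat θ t g x :=
  lintegral_mono fun y => mul_le_mul_right (h y) _

theorem heat_add {f g : EuclideanSpace ℝ (Fin N) → ℝ≥0∞} (hf : Measurable f)
    (x : EuclideanSpace ℝ (Fin N)) :
    heat θ t (fun y => f y + g y) x = heat θ t f x + heat θ t g x := by
  simp only [heat, mul_add]
  exact lintegral_add_left ((measurable_ofReal_fundSol_sub x t).mul hf) _

theorem heat_const_mul {f : EuclideanSpace ℝ (Fin N) → ℝ≥0∞} (hf : Measurable f) (c : ℝ≥0∞)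
    (x : EuclideanSpace ℝ (Fin N)) :
    heat θ t (fun y => c * f y) x = c * heat θ t f x := by
  simp only [heat]
  have h := lintegral_const_mul (μ := volume) c ((measurable_ofReal_fundSol_sub (θ := θ) x t).mul hf)
  simp only [Pi.mul_apply] at h
  rw [← h]
  congr 1 with y
  ring

theorem heat_const (hN : 1 ≤ N) (hθ : 0 < θ) (hθ2 : θ ≤ 2) (ht : 0 < t) (c : ℝ≥0∞)
    (x : EuclideanSpace ℝ (Fin N)) : heat θ t (fun _ => c) x = c := by
  rw [heat, lintegral_mul_const c (measurable_ofReal_fundSol_sub x t),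
    lintegral_fundSol hN hθ hθ2 ht, one_mul]

theorem heat_eq_lintegral_withDensity {f : EuclideanSpace ℝ (Fin N) → ℝ≥0∞} (hf : Measurable f)
    (x : EuclideanSpace ℝ (Fin N)) :
    heat θ t f x =
      ∫⁻ y, f y ∂volume.withDensity fun y => ENNReal.ofReal (fundSol θ (x - y) t) := by
  rw [heat, lintegral_withDensity_eq_lintegral_mul _ (measurable_ofReal_fundSol_sub x t) hf]
  rfl

/-- Jensen's inequality, the kernel being a probability density. -/
theorem heat_rpow_le (hN : 1 ≤ N) (hθ : 0 < θ) (hθ2 : θ ≤ 2) (ht : 0 < t)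
    {f : EuclideanSpace ℝ (Fin N) → ℝ≥0∞} (hf : Measurable f) {p q : ℝ} (hp : 0 < p)
    (hpq : p ≤ q) (x : EuclideanSpace ℝ (Fin N)) :
    heat θ t (fun y => f y ^ p) x ^ (1 / p) ≤ heat θ t (fun y => f y ^ q) x ^ (1 / q) := by
  have : IsProbabilityMeasure
      (volume.withDensity fun y => ENNReal.ofReal (fundSol θ (x - y) t)) :=
    ⟨by rw [withDensity_apply _ .univ, setLIntegral_univ, lintegral_fundSol hN hθ hθ2 ht x]⟩
  rw [heat_eq_lintegral_withDensity (hf.pow_const p), heat_eq_lintegral_withDensity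
    (hf.pow_const q)]
  exact lintegral_rpow_le_lintegral_rpow hf.aemeasurable hp hpq

theorem measurable_uncurry_heat {f : EuclideanSpace ℝ (Fin N) → ℝ≥0∞} (hf : Measurable f) :
    Measurable fun z : EuclideanSpace ℝ (Fin N) × ℝ => heat θ z.2 f z.1 := by
  unfold heat
  refine Measurable.lintegral_prod_right'
    (f := fun (w : (EuclideanSpace ℝ (Fin N) × ℝ) × EuclideanSpace ℝ (Fin N)) =>
      ENNReal.ofReal (fundSol θ (w.1.1 - w.2) w.1.2) * f w.2) ?_
  refine Measurable.mul (ENNReal.measurable_ofReal.comp (measurable_fundSol.comp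
    (f := fun w : (EuclideanSpace ℝ (Fin N) × ℝ) × EuclideanSpace ℝ (Fin N) =>
      (w.1.1 - w.2, w.1.2)) (by fun_prop))) (hf.comp measurable_snd)

theorem measurable_heat {f : EuclideanSpace ℝ (Fin N) → ℝ≥0∞} (hf : Measurable f) :
    Measurable (heat θ t f) :=
  (measurable_uncurry_heat hf).comp (f := fun x => (x, t)) (by fun_prop)

theorem heat_heat (hN : 1 ≤ N) (hθ : 0 < θ) (hθ2 : θ ≤ 2) (ht : 0 < t) (hs : 0 < s)
    {f : EuclideanSpace ℝ (Fin N) → ℝ≥0∞} (hf : Measurable f) (x : EuclideanSpace ℝ (Fin N)) :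
    heat θ t (heat θ s f) x = heat θ (t + s) f x := by
  have hm : Measurable fun w : EuclideanSpace ℝ (Fin N) × EuclideanSpace ℝ (Fin N) =>
      ENNReal.ofReal (fundSol θ (w.1 - w.2) s) * f w.2 :=
    Measurable.mul (ENNReal.measurable_ofReal.comp (measurable_fundSol.comp
      (f := fun w : EuclideanSpace ℝ (Fin N) × EuclideanSpace ℝ (Fin N) => (w.1 - w.2, s))
      (by fun_prop))) (hf.comp measurable_snd)
  have hm2 : Measurable fun w : EuclideanSpace ℝ (Fin N) × EuclideanSpace ℝ (Fin N) =>
      ENNReal.ofReal (fundSol θ (x - w.1) t) *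
        (ENNReal.ofReal (fundSol θ (w.1 - w.2) s) * f w.2) :=
    ((measurable_ofReal_fundSol_sub x t).comp measurable_fst).mul hm
  calc heat θ t (heat θ s f) x
      = ∫⁻ y, ∫⁻ z, ENNReal.ofReal (fundSol θ (x - y) t) *
          (ENNReal.ofReal (fundSol θ (y - z) s) * f z) := by
        unfold heat
        congr 1 with y
        exact (lintegral_const_mul _ (hm.comp (f := fun z => (y, z)) (by fun_prop))).symm
    _ = ∫⁻ z, ∫⁻ y, ENNReal.ofReal (fundSol θ (x - y) t) *
          (ENNReal.ofReal (fundSol θ (y - z) s) * f z) :=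
        lintegral_lintegral_swap hm2.aemeasurable
    _ = heat θ (t + s) f x := by
        unfold heat
        congr 1 with z
        rw [← lintegral_fundSol_mul hN hθ hθ2 ht hs, ← lintegral_mul_const]
        · congr 1 with y
          ring
        · exact (measurable_ofReal_fundSol_sub x t).mul (ENNReal.measurable_ofReal.comp
            (measurable_fundSol.comp (f := fun y => (y - z, s)) (by fun_prop)))

/-- The Duhamel integral of a measurable source is measurable. -/
theorem measurable_duhamel {Φ : EuclideanSpace ℝ (Fin N) → ℝ → ℝ≥0∞}
    (hΦ : Measurable (Function.uncurry Φ)) :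
    Measurable fun z : EuclideanSpace ℝ (Fin N) × ℝ =>
      ∫⁻ s in Ioo 0 z.2, heat θ (z.2 - s) (fun y => Φ y s) z.1 := by
  have hin : Measurable fun w : (EuclideanSpace ℝ (Fin N) × ℝ) × ℝ =>
      heat θ (w.1.2 - w.2) (fun y => Φ y w.2) w.1.1 := by
    unfold heat
    refine Measurable.lintegral_prod_right'
      (f := fun (v : ((EuclideanSpace ℝ (Fin N) × ℝ) × ℝ) × EuclideanSpace ℝ (Fin N)) =>
        ENNReal.ofReal (fundSol θ (v.1.1.1 - v.2) (v.1.1.2 - v.1.2)) * Φ v.2 v.1.2) ?_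
    refine Measurable.mul (ENNReal.measurable_ofReal.comp (measurable_fundSol.comp
      (f := fun v : ((EuclideanSpace ℝ (Fin N) × ℝ) × ℝ) × EuclideanSpace ℝ (Fin N) =>
        (v.1.1.1 - v.2, v.1.1.2 - v.1.2)) (by fun_prop)))
      (hΦ.comp (f := fun v : ((EuclideanSpace ℝ (Fin N) × ℝ) × ℝ) × EuclideanSpace ℝ (Fin N) =>
        (v.2, v.1.2)) (by fun_prop))
  have hset : MeasurableSet {w : (EuclideanSpace ℝ (Fin N) × ℝ) × ℝ | w.2 ∈ Ioo 0 w.1.2} :=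
    (measurableSet_lt measurable_const measurable_snd).inter
      (measurableSet_lt measurable_snd (by fun_prop))
  have h := (hin.indicator hset).lintegral_prod_right' (ν := (volume : Measure ℝ))
  convert h using 2 with z
  rw [← lintegral_indicator measurableSet_Ioo]
  rfl

/-! ### Bound by averages over balls -/

/-- Away from the origin, B(z,σ) contains a ball of radius σ/2 shifted towards 0 on which K ≥ K(z);
near the origin, K(z) ≤ K(0) is enough. -/
theorem RadDec.volume_ball_mul_le {K : EuclideanSpace ℝ (Fin N) → ℝ} (hK : RadDec K) {σ : ℝ}
    (hσ : 0 < σ) (z : EuclideanSpace ℝ (Fin N)) :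
    volume (Metric.ball (0 : EuclideanSpace ℝ (Fin N)) (σ / 2)) * ENNReal.ofReal (K z) ≤
      (∫⁻ w in Metric.ball z σ, ENNReal.ofReal (K w)) +
        volume (Metric.ball (0 : EuclideanSpace ℝ (Fin N)) (σ / 2)) *
          (Metric.ball 0 σ).indicator (fun _ => ENNReal.ofReal (K 0)) z := by
  by_cases hz : ‖z‖ < σ / 2
  · have hz' : z ∈ Metric.ball (0 : EuclideanSpace ℝ (Fin N)) σ := by
      rw [mem_ball_zero_iff]; linarith
    rw [indicator_of_mem hz']
    refine le_add_left (mul_le_mul_right (ENNReal.ofReal_le_ofReal ?_) _)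
    exact hK.anti 0 z (by simp)
  · refine le_add_right ?_
    push Not at hz
    have hz0 : 0 < ‖z‖ := by linarith
    -- The point of the segment from 0 to z at distance σ/2 from z: every w in B(c, σ/2) satisfies
    -- |w| ≤ |z|.
    set c : EuclideanSpace ℝ (Fin N) := (1 - σ / 2 / ‖z‖) • z with hc
    have hq : σ / 2 / ‖z‖ ≤ 1 := (div_le_one hz0).2 hz
    have hcn : ‖c‖ = ‖z‖ - σ / 2 := by
      rw [hc, norm_smul, Real.norm_of_nonneg (by linarith)]
      field_simp
    have hcz : ‖c - z‖ = σ / 2 := by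
      have : c - z = -((σ / 2 / ‖z‖) • z) := by rw [hc]; module
      rw [this, norm_neg, norm_smul, Real.norm_of_nonneg (by positivity)]
      field_simp
    have hsub : Metric.ball c (σ / 2) ⊆ Metric.ball z σ := by
      refine Metric.ball_subset_ball' ?_
      rw [dist_eq_norm, hcz]
      linarith
    calc volume (Metric.ball (0 : EuclideanSpace ℝ (Fin N)) (σ / 2)) * ENNReal.ofReal (K z)
        = ∫⁻ _ in Metric.ball c (σ / 2), ENNReal.ofReal (K z) := by
          rw [setLIntegral_const, mul_comm, Measure.addHaar_ball_center volume c]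
      _ ≤ ∫⁻ w in Metric.ball c (σ / 2), ENNReal.ofReal (K w) := by
          refine setLIntegral_mono_ae' measurableSet_ball (Eventually.of_forall fun w hw => ?_)
          refine ENNReal.ofReal_le_ofReal (hK.anti w z ?_)
          rw [Metric.mem_ball, dist_eq_norm] at hw
          calc ‖w‖ = ‖(w - c) + c‖ := by rw [sub_add_cancel]
            _ ≤ ‖w - c‖ + ‖c‖ := norm_add_le _ _
            _ ≤ ‖z‖ := by linarith
      _ ≤ _ := lintegral_mono_set hsub

theorem setLIntegral_ball_le (f : EuclideanSpace ℝ (Fin N) → ℝ≥0∞) (σ : ℝ)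
    (z : EuclideanSpace ℝ (Fin N)) :
    ∫⁻ y in Metric.ball z σ, f y ≤ volume (Metric.ball (0 : EuclideanSpace ℝ (Fin N)) σ) *
      ⨆ x, ⨍⁻ y in Metric.ball x σ, f y ∂volume := by
  rw [← measure_mul_setLAverage f measure_ball_lt_top.ne, Measure.addHaar_ball_center]
  exact mul_le_mul_right (le_iSup (fun x => ⨍⁻ y in Metric.ball x σ, f y ∂volume) z) _

/-- Integrate `RadDec.volume_ball_mul_le` at z = x - y against f. By Tonelli the first term averages
ball integrals of f against a kernel of mass one; the second is K(0) times one ball integral. -/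
theorem heat_le_iSup_setLAverage (hN : 1 ≤ N) (hθ : 0 < θ) (hθ2 : θ ≤ 2) :
    ∃ C : ℝ, 0 < C ∧ ∀ t, 0 < t → ∀ f : EuclideanSpace ℝ (Fin N) → ℝ≥0∞, Measurable f →
      ∀ x, heat θ t f x ≤ ENNReal.ofReal C *
        ⨆ z, ⨍⁻ y in Metric.ball z (t ^ (1 / θ)), f y ∂volume := by
  set v := (volume (Metric.ball (0 : EuclideanSpace ℝ (Fin N)) 1)).toReal with hv
  have hvE : ENNReal.ofReal v = volume (Metric.ball (0 : EuclideanSpace ℝ (Fin N)) 1) :=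
    ENNReal.ofReal_toReal measure_ball_lt_top.ne
  set k := fundSol θ (0 : EuclideanSpace ℝ (Fin N)) 1 with hk
  have hk0 : 0 ≤ k := (fundSol_radDec hN hθ hθ2 one_pos).nonneg 0
  have hv0 : 0 ≤ v := ENNReal.toReal_nonneg
  refine ⟨2 ^ N * (1 + (1 / 2) ^ N * v * k), by positivity, fun t ht f hf x => ?_⟩
  set σ := t ^ (1 / θ) with hσdef
  have hσ : 0 < σ := by positivity
  set A := ⨆ z, ⨍⁻ y in Metric.ball z σ, f y ∂volume with hA
  set K : EuclideanSpace ℝ (Fin N) → ℝ := fun y => fundSol θ y t with hKdef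
  have hK : RadDec K := fundSol_radDec hN hθ hθ2 ht
  have hKm : Measurable fun y => ENNReal.ofReal (K y) :=
    ENNReal.measurable_ofReal.comp (measurable_fundSol.comp (f := fun y => (y, t)) (by fun_prop))
  have hvol : ∀ r, 0 < r → volume (Metric.ball (0 : EuclideanSpace ℝ (Fin N)) r) =
      ENNReal.ofReal (r ^ N * v) := fun r hr => by
    rw [Measure.addHaar_ball_of_pos _ _ hr, finrank_euclideanSpace, Fintype.card_fin,
      ENNReal.ofReal_mul (by positivity), hvE]
  set v' := volume (Metric.ball (0 : EuclideanSpace ℝ (Fin N)) (σ / 2)) with hv'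
  have hv'0 : v' ≠ 0 := (Metric.measure_ball_pos _ _ (by positivity)).ne'
  have hv't : v' ≠ ∞ := measure_ball_lt_top.ne
  have hVσ : volume (Metric.ball (0 : EuclideanSpace ℝ (Fin N)) σ) =
      v' * ENNReal.ofReal (2 ^ N) := by
    rw [hv', hvol _ hσ, hvol _ (by positivity), ← ENNReal.ofReal_mul (by positivity)]
    congr 1
    rw [div_pow]
    field_simp
  -- With σ = t^(1/θ) the volume σ^N cancels the t^(-N/θ) of the kernel at 0, so the constant does
  -- not depend on t.
  have hcore : v' * ENNReal.ofReal (K 0) = ENNReal.ofReal ((1 / 2) ^ N * v * k) := by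
    rw [hv', hvol _ (by positivity), ← ENNReal.ofReal_mul (by positivity), hKdef]
    simp only
    rw [fundSol_zero ht hθ, ← hσdef, ← hk]
    congr 1
    rw [div_pow, div_pow, one_pow]
    field_simp
  have hfirst : ∫⁻ y, (∫⁻ w in Metric.ball (x - y) σ, ENNReal.ofReal (K w)) * f y ≤
      volume (Metric.ball (0 : EuclideanSpace ℝ (Fin N)) σ) * A := by
    have hmem : ∀ y w, w ∈ Metric.ball (x - y) σ ↔ y ∈ Metric.ball (x - w) σ := by
      intro y w
      rw [Metric.mem_ball, Metric.mem_ball, dist_eq_norm, dist_eq_norm,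
        show w - (x - y) = y - (x - w) by abel]
    have hS : MeasurableSet {z : EuclideanSpace ℝ (Fin N) × EuclideanSpace ℝ (Fin N) |
        dist z.2 (x - z.1) < σ} := measurableSet_lt (by fun_prop) measurable_const
    have hm : Measurable fun z : EuclideanSpace ℝ (Fin N) × EuclideanSpace ℝ (Fin N) =>
        {z : EuclideanSpace ℝ (Fin N) × EuclideanSpace ℝ (Fin N) |
        dist z.2 (x - z.1) < σ}.indicator (fun z => ENNReal.ofReal (K z.2) * f z.1) z :=
      ((hKm.comp measurable_snd).mul (hf.comp measurable_fst)).indicator hS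
    calc ∫⁻ y, (∫⁻ w in Metric.ball (x - y) σ, ENNReal.ofReal (K w)) * f y
        = ∫⁻ y, ∫⁻ w, {z : EuclideanSpace ℝ (Fin N) × EuclideanSpace ℝ (Fin N) |
            dist z.2 (x - z.1) < σ}.indicator (fun z => ENNReal.ofReal (K z.2) * f z.1)
              (y, w) := by
          congr 1 with y
          rw [← lintegral_mul_const _ hKm, ← lintegral_indicator measurableSet_ball]
          rfl
      _ = ∫⁻ w, ∫⁻ y, {z : EuclideanSpace ℝ (Fin N) × EuclideanSpace ℝ (Fin N) |
            dist z.2 (x - z.1) < σ}.indicator (fun z => ENNReal.ofReal (K z.2) * f z.1)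
              (y, w) := lintegral_lintegral_swap hm.aemeasurable
      _ = ∫⁻ w, ENNReal.ofReal (K w) * ∫⁻ y in Metric.ball (x - w) σ, f y := by
          congr 1 with w
          rw [← lintegral_const_mul _ hf, ← lintegral_indicator measurableSet_ball]
          congr 1 with y
          by_cases h : y ∈ Metric.ball (x - w) σ
          · rw [indicator_of_mem h, indicator_of_mem]
            exact (hmem y w).2 h
          · rw [indicator_of_notMem h, indicator_of_notMem]
            exact fun h' => h ((hmem y w).1 h')
      _ ≤ ∫⁻ w, ENNReal.ofReal (K w) *
            (volume (Metric.ball (0 : EuclideanSpace ℝ (Fin N)) σ) * A) :=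
          lintegral_mono fun w => mul_le_mul_right (setLIntegral_ball_le f σ _) _
      _ = _ := by
          have := lintegral_fundSol hN hθ hθ2 ht (0 : EuclideanSpace ℝ (Fin N))
          rw [lintegral_sub_left_eq_self (fun y => ENNReal.ofReal (fundSol θ y t))
            (0 : EuclideanSpace ℝ (Fin N))] at this
          rw [lintegral_mul_const _ hKm, this, one_mul]
  have hsecond : ∫⁻ y, v' * (Metric.ball 0 σ).indicator (fun _ => ENNReal.ofReal (K 0)) (x - y) *
      f y ≤ v' * ENNReal.ofReal (K 0) *
        (volume (Metric.ball (0 : EuclideanSpace ℝ (Fin N)) σ) * A) := by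
    calc _ = ∫⁻ y in Metric.ball x σ, v' * ENNReal.ofReal (K 0) * f y := by
          rw [← lintegral_indicator measurableSet_ball]
          congr 1 with y
          have : x - y ∈ Metric.ball (0 : EuclideanSpace ℝ (Fin N)) σ ↔ y ∈ Metric.ball x σ := by
            rw [mem_ball_zero_iff, Metric.mem_ball', dist_eq_norm]
          by_cases h : y ∈ Metric.ball x σ
          · rw [indicator_of_mem h, indicator_of_mem (this.2 h)]
          · rw [indicator_of_notMem h, indicator_of_notMem fun h' => h (this.1 h')]
            simp
      _ = v' * ENNReal.ofReal (K 0) * ∫⁻ y in Metric.ball x σ, f y :=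
          lintegral_const_mul _ hf
      _ ≤ _ := mul_le_mul_right (setLIntegral_ball_le f σ _) _
  have hmeas1 : Measurable fun y =>
      v' * (Metric.ball 0 σ).indicator (fun _ => ENNReal.ofReal (K 0)) (x - y) * f y := by
    refine Measurable.mul (Measurable.const_mul ?_ _) hf
    exact (measurable_const.indicator measurableSet_ball).comp (measurable_const.sub measurable_id)
  have hmain : v' * heat θ t f x ≤
      v' * (ENNReal.ofReal (2 ^ N * (1 + (1 / 2) ^ N * v * k)) * A) := by
    calc v' * heat θ t f x
        = ∫⁻ y, v' * ENNReal.ofReal (K (x - y)) * f y := by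
          rw [← heat_const_mul hf v' x, heat]
          congr 1 with y
          ring
      _ ≤ ∫⁻ y, ((∫⁻ w in Metric.ball (x - y) σ, ENNReal.ofReal (K w)) * f y +
            v' * (Metric.ball 0 σ).indicator (fun _ => ENNReal.ofReal (K 0)) (x - y) * f y) := by
          refine lintegral_mono fun y => ?_
          rw [← add_mul]
          exact mul_le_mul_left (hK.volume_ball_mul_le hσ _) _
      _ ≤ volume (Metric.ball (0 : EuclideanSpace ℝ (Fin N)) σ) * A + v' * ENNReal.ofReal (K 0) *
            (volume (Metric.ball (0 : EuclideanSpace ℝ (Fin N)) σ) * A) := by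
          rw [lintegral_add_right _ hmeas1]
          exact add_le_add hfirst hsecond
      _ = _ := by
          rw [hVσ, hcore, ENNReal.ofReal_mul (p := 2 ^ N) (by positivity),
            ENNReal.ofReal_add (by positivity) (by positivity), ENNReal.ofReal_one]
          ring
  exact (ENNReal.mul_le_mul_iff_right hv'0 hv't).1 hmain

end Heat

/-! ### The scale function `t ↦ t^(-1/(p-1)) G(1/t)^(-1/(p-1))` -/

/-- The function `t ↦ t^(-1/(p-1)) G(1/t)^(-1/(p-1))`. -/
noncomputable def profile (G : ℝ → ℝ) (p t : ℝ) : ℝ :=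
  t ^ (-(1 / (p - 1))) * G t⁻¹ ^ (-(1 / (p - 1)))

section Profile

variable {F G : ℝ → ℝ} {p R δ θ : ℝ}

theorem profile_eq {t : ℝ} (ht : 0 < t) (hG : 0 < G t⁻¹) :
    profile G p t = (t * G t⁻¹) ^ (-(1 / (p - 1))) :=
  (Real.mul_rpow ht.le hG.le).symm

theorem profile_pos {t : ℝ} (ht : 0 < t) (hG : 0 < G t⁻¹) : 0 < profile G p t := by
  rw [profile_eq ht hG]
  positivity

theorem profile_rpow {t : ℝ} (ht : 0 < t) (hG : 0 < G t⁻¹) (r : ℝ) :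
    profile G p t ^ r = (t * G t⁻¹) ^ (-(r / (p - 1))) := by
  rw [profile_eq ht hG, ← Real.rpow_mul (by positivity)]
  congr 1
  ring

theorem eventually_pos_of_asympLE (hC2 : AsympLE (fun τ => τ ^ (-p) * F τ) G)
    (hC2pos : ∀ᶠ τ in atTop, 0 < τ ^ (-p) * F τ) : ∀ᶠ τ in atTop, 0 < G τ := by
  obtain ⟨C, hC, h⟩ := hC2
  filter_upwards [h, hC2pos] with τ h1 h2
  exact pos_of_mul_pos_right (h2.trans_le h1) hC.le

/-- By (C4), t G(1/t) ≤ C t^(1-δ) → 0, and the profile is a negative power of it. -/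
theorem tendsto_profile (hp : 1 < p) (hG : ∀ᶠ τ in atTop, 0 < G τ) (hδ : δ < 1)
    (hC4 : AntitoneOn (fun τ : ℝ => τ ^ (-δ) * G τ) (Ioi R)) :
    Tendsto (profile G p) (𝓝[>] 0) atTop := by
  have hGt := tendsto_inv_nhdsGT_zero.eventually hG
  set τ₁ := max R 0 + 1 with hτ₁
  have hRτ₁ : R < τ₁ := by rw [hτ₁]; linarith [le_max_left R 0]
  have hev := tendsto_inv_nhdsGT_zero.eventually (eventually_ge_atTop τ₁)
  have h0 : Tendsto (fun t => t * G t⁻¹) (𝓝[>] 0) (𝓝[>] 0) := by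
    refine tendsto_nhdsWithin_iff.2 ⟨?_, ?_⟩
    · have hlim : Tendsto (fun t : ℝ => (τ₁ ^ (-δ) * G τ₁) * t ^ (1 - δ)) (𝓝[>] 0) (𝓝 0) := by
        have : Tendsto (fun t : ℝ => t ^ (1 - δ)) (𝓝[>] 0) (𝓝 ((0 : ℝ) ^ (1 - δ))) :=
          ((Real.continuousAt_rpow_const 0 (1 - δ) (Or.inr (by linarith))).tendsto).mono_left
            nhdsWithin_le_nhds
        rw [Real.zero_rpow (by linarith)] at this
        simpa using this.const_mul (τ₁ ^ (-δ) * G τ₁)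
      refine tendsto_of_tendsto_of_tendsto_of_le_of_le' tendsto_const_nhds hlim ?_ ?_
      · filter_upwards [hGt, self_mem_nhdsWithin] with t h1 (h2 : 0 < t)
        positivity
      · filter_upwards [hev, self_mem_nhdsWithin] with t h1 (h2 : 0 < t)
        have h3 := hC4 hRτ₁ (hRτ₁.trans_le h1) h1
        simp only at h3
        rw [Real.inv_rpow h2.le, Real.rpow_neg h2.le, inv_inv] at h3
        calc t * G t⁻¹ = (t ^ δ * G t⁻¹) * t ^ (1 - δ) := by
              have : t = t ^ δ * t ^ (1 - δ) := by
                rw [← Real.rpow_add h2]; simp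
              nth_rewrite 1 [this]
              ring
          _ ≤ _ := by gcongr
    · filter_upwards [hGt, self_mem_nhdsWithin] with t h1 (h2 : 0 < t)
      exact mul_pos h2 h1
  have h1 := (tendsto_rpow_neg_nhdsGT_zero (y := -(1 / (p - 1)))
    (by simpa using hp)).comp h0
  refine h1.congr' ?_
  filter_upwards [hGt, self_mem_nhdsWithin] with t h1 (h2 : 0 < t)
  exact (profile_eq h2 h1).symm

theorem profile_inv {τ : ℝ} (hτ : 0 < τ) :
    profile G p τ⁻¹ = 1 * τ ^ (1 / (p - 1)) * G τ ^ (-(1 / (p - 1))) := by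
  rw [profile, inv_inv, Real.inv_rpow hτ.le, ← Real.rpow_neg hτ.le, neg_neg, one_mul]

/-- (C2) gives F(h) ≤ C h^p G(h). By construction h^(p-1) = 1/(s G(1/s)), and (C3) with a = 1, b =
1/(p-1), c = -1/(p-1) compares G(h) with G(1/s), so G cancels. -/
theorem eventually_nonlinearity_profile_le (hp : 1 < p) (hδ : δ < 1)
    (hC2 : AsympLE (fun τ => τ ^ (-p) * F τ) G)
    (hC2pos : ∀ᶠ τ in atTop, 0 < τ ^ (-p) * F τ)
    (hC3 : ∀ a b c : ℝ, 1 ≤ a → 0 < b → AsympEq (fun τ => G (a * τ ^ b * G τ ^ c)) G)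
    (hC4 : AntitoneOn (fun τ : ℝ => τ ^ (-δ) * G τ) (Ioi R)) :
    ∃ C, 0 < C ∧ ∀ᶠ s in 𝓝[>] (0 : ℝ), F (profile G p s) ≤ C * profile G p s * s⁻¹ := by
  have hG := eventually_pos_of_asympLE hC2 hC2pos
  have hlim := tendsto_profile hp hG hδ hC4
  obtain ⟨C₁, hC₁, h1⟩ := hC2
  obtain ⟨C₂, hC₂, h2⟩ := (hC3 1 (1 / (p - 1)) (-(1 / (p - 1))) le_rfl
    (by simpa using hp)).1
  refine ⟨C₁ * C₂, mul_pos hC₁ hC₂, ?_⟩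
  filter_upwards [hlim.eventually h1, tendsto_inv_nhdsGT_zero.eventually h2,
    tendsto_inv_nhdsGT_zero.eventually hG, self_mem_nhdsWithin] with s e1 e2 e3 (hs : 0 < s)
  have hs' : 0 < s⁻¹ := inv_pos.2 hs
  rw [← profile_inv hs', inv_inv] at e2
  have hH := profile_pos (p := p) hs e3
  have hHp : profile G p s ^ p = profile G p s * (s⁻¹ * (G s⁻¹)⁻¹) := by
    have : profile G p s ^ (p - 1) = s⁻¹ * (G s⁻¹)⁻¹ := by
      rw [profile_rpow hs e3, div_self (by linarith), Real.rpow_neg_one, mul_inv]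
    rw [← this]
    nth_rewrite 2 [← Real.rpow_one (profile G p s)]
    rw [← Real.rpow_add hH]
    congr 1
    ring
  rw [Real.rpow_neg hH.le] at e1
  have hHp0 : 0 < profile G p s ^ p := by positivity
  calc F (profile G p s)
      = profile G p s ^ p * ((profile G p s ^ p)⁻¹ * F (profile G p s)) := by
        rw [mul_inv_cancel_left₀ hHp0.ne']
    _ ≤ profile G p s ^ p * (C₁ * (C₂ * G s⁻¹)) :=
        mul_le_mul_of_nonneg_left (e1.trans (mul_le_mul_of_nonneg_left e2 hC₁.le)) hHp0.le
    _ = C₁ * C₂ * profile G p s * s⁻¹ := by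
        rw [hHp]
        generalize G s⁻¹ = g at e3 ⊢
        field_simp

/-- Converts the bound at radius σ = t^(1/θ) into one in t, by (C3) with a = 1, b = 1/θ, c = 0. -/
theorem eventually_scaled_profile_le (hp : 1 < p) (hθ : 0 < θ)
    (hG : ∀ᶠ τ in atTop, 0 < G τ)
    (hC3 : ∀ a b c : ℝ, 1 ≤ a → 0 < b → AsympEq (fun τ => G (a * τ ^ b * G τ ^ c)) G) :
    ∃ C, 0 < C ∧ ∀ᶠ t in 𝓝[>] (0 : ℝ),
      (t ^ (1 / θ)) ^ (-(θ / (p - 1))) * G (t ^ (1 / θ))⁻¹ ^ (-(1 / (p - 1))) ≤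
        C * profile G p t := by
  obtain ⟨C, hC, h⟩ := (hC3 1 (1 / θ) 0 le_rfl (by positivity)).2
  refine ⟨C ^ (1 / (p - 1)), by positivity, ?_⟩
  filter_upwards [tendsto_inv_nhdsGT_zero.eventually h, tendsto_inv_nhdsGT_zero.eventually hG,
    self_mem_nhdsWithin] with t h1 h2 (ht : 0 < t)
  rw [Real.rpow_zero, mul_one, one_mul, Real.inv_rpow ht.le] at h1
  have h3 : 0 < G (t ^ (1 / θ))⁻¹ := pos_of_mul_pos_right (h2.trans_le h1) hC.le
  have hq : 0 < 1 / (p - 1) := by simpa using hp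
  have e1 : (t ^ (1 / θ)) ^ (-(θ / (p - 1))) = t ^ (-(1 / (p - 1))) := by
    rw [← Real.rpow_mul ht.le]
    congr 1
    field_simp
  have e2 : G (t ^ (1 / θ))⁻¹ ^ (-(1 / (p - 1))) ≤
      C ^ (1 / (p - 1)) * G t⁻¹ ^ (-(1 / (p - 1))) := by
    have h4 : (C * G (t ^ (1 / θ))⁻¹) ^ (-(1 / (p - 1))) ≤ G t⁻¹ ^ (-(1 / (p - 1))) :=
      Real.rpow_le_rpow_of_nonpos h2 h1 (by linarith)
    rw [Real.mul_rpow hC.le h3.le] at h4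
    calc _ = C ^ (1 / (p - 1)) * (C ^ (-(1 / (p - 1))) *
          G (t ^ (1 / θ))⁻¹ ^ (-(1 / (p - 1)))) := by
          rw [← mul_assoc, ← Real.rpow_add hC, add_neg_cancel, Real.rpow_zero, one_mul]
      _ ≤ _ := by gcongr
  rw [e1, profile]
  calc _ ≤ t ^ (-(1 / (p - 1))) * (C ^ (1 / (p - 1)) * G t⁻¹ ^ (-(1 / (p - 1)))) := by gcongr
    _ = _ := by ring

theorem lintegral_rpow_Ioo {a t : ℝ} (ha : 0 < a) (ht : 0 < t) :
    ∫⁻ s in Ioo 0 t, ENNReal.ofReal (s ^ (a - 1)) = ENNReal.ofReal (t ^ a / a) := by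
  have hi := intervalIntegral.intervalIntegrable_rpow' (a := 0) (b := t) (r := a - 1)
    (by linarith)
  rw [intervalIntegrable_iff_integrableOn_Ioo_of_le ht.le] at hi
  rw [← ofReal_integral_eq_lintegral_ofReal hi]
  · congr 1
    rw [← integral_Ioc_eq_integral_Ioo, ← intervalIntegral.integral_of_le ht.le,
      integral_rpow (Or.inl (by linarith))]
    simp [Real.zero_rpow ha.ne']
  · filter_upwards [ae_restrict_mem measurableSet_Ioo] with s hs
    have : 0 < s := hs.1
    simp only [Pi.zero_apply]
    positivity

/-- Here h(s)^(1-α) = (s G(1/s))^γ with γ > 0. (C4) bounds s^δ G(1/s) by its value at t, leaving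
s^((1-δ)γ-1), integrable at 0 as δ < 1. -/
theorem lintegral_profile_rpow_le (hp : 1 < p) (hδ : δ < 1)
    (hC4 : AntitoneOn (fun τ : ℝ => τ ^ (-δ) * G τ) (Ioi R)) {α : ℝ} (hα : 1 < α) {t : ℝ}
    (ht : 0 < t) (htR : R < t⁻¹) (hG : ∀ s ∈ Ioc 0 t, 0 < G s⁻¹) :
    ∫⁻ s in Ioo 0 t, ENNReal.ofReal (profile G p s ^ (1 - α) * s⁻¹) ≤
      ENNReal.ofReal (1 / ((1 - δ) * ((α - 1) / (p - 1))) * profile G p t ^ (1 - α)) := by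
  set γ := (α - 1) / (p - 1) with hγ
  have hγ0 : 0 < γ := div_pos (by linarith) (by linarith)
  have hGt : 0 < G t⁻¹ := hG t ⟨ht, le_rfl⟩
  have hpow : ∀ s, 0 < s → 0 < G s⁻¹ → profile G p s ^ (1 - α) = (s * G s⁻¹) ^ γ := by
    intro s hs hGs
    rw [profile_rpow hs hGs]
    congr 1
    rw [hγ]
    ring
  have hptw : ∀ s ∈ Ioo 0 t, profile G p s ^ (1 - α) * s⁻¹ ≤
      (t ^ δ * G t⁻¹) ^ γ * s ^ ((1 - δ) * γ - 1) := by
    intro s hs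
    have hs0 : 0 < s := hs.1
    have hGs : 0 < G s⁻¹ := hG s ⟨hs.1, hs.2.le⟩
    have hle : t⁻¹ ≤ s⁻¹ := inv_anti₀ hs0 hs.2.le
    have h1 := hC4 htR (htR.trans_le hle) hle
    simp only at h1
    rw [Real.inv_rpow hs0.le, Real.rpow_neg hs0.le, inv_inv, Real.inv_rpow ht.le,
      Real.rpow_neg ht.le, inv_inv] at h1
    rw [hpow s hs0 hGs]
    have h2 : s * G s⁻¹ ≤ (t ^ δ * G t⁻¹) * s ^ (1 - δ) := by
      calc s * G s⁻¹ = (s ^ δ * G s⁻¹) * s ^ (1 - δ) := by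
            have : s = s ^ δ * s ^ (1 - δ) := by
              rw [← Real.rpow_add hs0]; simp
            nth_rewrite 1 [this]
            ring
        _ ≤ _ := by gcongr
    calc (s * G s⁻¹) ^ γ * s⁻¹ ≤ ((t ^ δ * G t⁻¹) * s ^ (1 - δ)) ^ γ * s⁻¹ := by gcongr
      _ = _ := by
        rw [Real.mul_rpow (by positivity) (by positivity), ← Real.rpow_mul hs0.le, mul_assoc,
          Real.rpow_sub_one hs0.ne', div_eq_mul_inv]
  have ha : 0 < (1 - δ) * γ := mul_pos (by linarith) hγ0
  calc _ ≤ ∫⁻ s in Ioo 0 t, ENNReal.ofReal ((t ^ δ * G t⁻¹) ^ γ) *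
        ENNReal.ofReal (s ^ ((1 - δ) * γ - 1)) := by
        refine setLIntegral_mono_ae' measurableSet_Ioo (Eventually.of_forall fun s hs => ?_)
        rw [← ENNReal.ofReal_mul (by positivity)]
        exact ENNReal.ofReal_le_ofReal (hptw s hs)
    _ = ENNReal.ofReal ((t ^ δ * G t⁻¹) ^ γ * (t ^ ((1 - δ) * γ) / ((1 - δ) * γ))) := by
        rw [lintegral_const_mul _ (by fun_prop), lintegral_rpow_Ioo ha ht,
          ← ENNReal.ofReal_mul (by positivity)]
    _ = _ := by
        congr 1
        rw [hpow t ht hGt, Real.rpow_mul ht.le, ← mul_div_assoc, ← Real.mul_rpow (by positivity)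
          (by positivity)]
        have : t ^ δ * G t⁻¹ * t ^ (1 - δ) = t * G t⁻¹ := by
          have : t = t ^ δ * t ^ (1 - δ) := by
            rw [← Real.rpow_add ht]; simp
          nth_rewrite 4 [this]
          ring
        rw [this]
        ring

end Profile

/-! ### Solutions from supersolutions by monotone iteration -/

/-- The Picard iterates of the integral equation, starting from zero. -/
noncomputable def picard {N : ℕ} (θ : ℝ) (F : ℝ → ℝ) (μ : EuclideanSpace ℝ (Fin N) → ℝ≥0∞) :
    ℕ → EuclideanSpace ℝ (Fin N) → ℝ → ℝ≥0∞
  | 0 => fun _ _ => 0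
  | n + 1 => fun x t => heat θ t μ x +
      ∫⁻ s in Ioo 0 t, heat θ (t - s) (fun y => ENNReal.ofReal (F (picard θ F μ n y s).toReal)) x

section Iteration

variable {N : ℕ} {θ : ℝ} {F : ℝ → ℝ} {μ : EuclideanSpace ℝ (Fin N) → ℝ≥0∞}

theorem measurable_ofReal_comp_toReal (hF : ContinuousOn F (Ici 0)) :
    Measurable fun v : ℝ≥0∞ => ENNReal.ofReal (F v.toReal) := by
  -- F is controlled only on [0, ∞), so it is replaced by an extension continuous on the whole line.
  have hc : Continuous fun τ : ℝ => F (max τ 0) :=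
    hF.comp_continuous (by fun_prop) fun τ => le_max_right τ 0
  have h := ENNReal.measurable_ofReal.comp (hc.measurable.comp ENNReal.measurable_toReal)
  convert h using 2 with v
  simp

theorem measurable_picard (hF : ContinuousOn F (Ici 0)) (hμ : Measurable μ) (n : ℕ) :
    Measurable (Function.uncurry (picard θ F μ n)) := by
  induction n with
  | zero => exact measurable_const
  | succ n ih =>
    exact (measurable_uncurry_heat hμ).add
      (measurable_duhamel (Φ := fun y s => ENNReal.ofReal (F (picard θ F μ n y s).toReal))
        ((measurable_ofReal_comp_toReal hF).comp ih))

theorem ofReal_comp_toReal_mono (hF : MonotoneOn F (Ici 0)) {v w : ℝ≥0∞} (h : v ≤ w)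
    (hw : w ≠ ∞) : ENNReal.ofReal (F v.toReal) ≤ ENNReal.ofReal (F w.toReal) :=
  ENNReal.ofReal_le_ofReal
    (hF ENNReal.toReal_nonneg ENNReal.toReal_nonneg (ENNReal.toReal_mono hw h))

theorem ofReal_comp_toReal_iSup (hFc : ContinuousOn F (Ici 0)) (hF : MonotoneOn F (Ici 0))
    {v : ℕ → ℝ≥0∞} (hv : Monotone v) (hfin : ⨆ n, v n ≠ ∞) :
    ENNReal.ofReal (F (⨆ n, v n).toReal) = ⨆ n, ENNReal.ofReal (F (v n).toReal) := by
  have hvn : ∀ n, v n ≠ ∞ := fun n => ne_top_of_le_ne_top hfin (le_iSup v n)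
  have h1 : Tendsto (fun n => ENNReal.ofReal (F (v n).toReal)) atTop
      (𝓝 (ENNReal.ofReal (F (⨆ n, v n).toReal))) := by
    refine ENNReal.tendsto_ofReal ?_
    refine (hFc _ ENNReal.toReal_nonneg).tendsto.comp (tendsto_nhdsWithin_iff.2 ⟨?_, ?_⟩)
    · exact (ENNReal.tendsto_toReal hfin).comp (tendsto_atTop_iSup hv)
    · exact Eventually.of_forall fun n => ENNReal.toReal_nonneg
  exact tendsto_nhds_unique h1 (tendsto_atTop_iSup fun m n hmn =>
    ofReal_comp_toReal_mono hF (hv hmn) (hvn n))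

/-- The Picard iterates from 0 increase and stay below U; monotone convergence in space and in time
passes the equation to their supremum. Finiteness of U keeps `toReal` monotone; U itself need not be
measurable. -/
theorem exists_isSolution_of_supersolution (hFc : ContinuousOn F (Ici 0))
    (hF : MonotoneOn F (Ici 0)) (hμ : Measurable μ) {T : ℝ}
    {U : EuclideanSpace ℝ (Fin N) → ℝ → ℝ≥0∞} (hfin : ∀ x, ∀ t ∈ Ioo 0 T, U x t ≠ ∞)
    (hU : ∀ x, ∀ t ∈ Ioo 0 T, heat θ t μ x + ∫⁻ s in Ioo 0 t,
      heat θ (t - s) (fun y => ENNReal.ofReal (F (U y s).toReal)) x ≤ U x t) :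
    ∃ u : EuclideanSpace ℝ (Fin N) → ℝ → ℝ, IsSolution θ F (volume.withDensity μ) T u ∧
      ∀ x, ∀ t ∈ Ioo 0 T, 0 ≤ u x t ∧ ENNReal.ofReal (u x t) ≤ U x t := by
  have hsub : ∀ {t s : ℝ}, t ∈ Ioo 0 T → s ∈ Ioo 0 t → s ∈ Ioo 0 T := fun ht hs =>
    ⟨hs.1, hs.2.trans ht.2⟩
  have hle : ∀ n x, ∀ t ∈ Ioo 0 T, picard θ F μ n x t ≤ U x t := by
    intro n
    induction n with
    | zero => exact fun x t _ => zero_le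
    | succ n ih =>
      intro x t ht
      refine le_trans (add_le_add_right ?_ _) (hU x t ht)
      refine setLIntegral_mono_ae' measurableSet_Ioo (Eventually.of_forall fun s hs => ?_)
      exact heat_mono (fun y => ofReal_comp_toReal_mono hF (ih y s (hsub ht hs))
        (hfin y s (hsub ht hs))) x
  have hpfin : ∀ n x, ∀ t ∈ Ioo 0 T, picard θ F μ n x t ≠ ∞ := fun n x t ht =>
    ne_top_of_le_ne_top (hfin x t ht) (hle n x t ht)
  have hmono : ∀ x, ∀ t ∈ Ioo 0 T, Monotone fun n => picard θ F μ n x t := by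
    suffices h : ∀ n x, ∀ t ∈ Ioo 0 T, picard θ F μ n x t ≤ picard θ F μ (n + 1) x t from
      fun x t ht => monotone_nat_of_le_succ fun n => h n x t ht
    intro n
    induction n with
    | zero => exact fun x t _ => zero_le
    | succ n ih =>
      intro x t ht
      refine add_le_add_right ?_ _
      refine setLIntegral_mono_ae' measurableSet_Ioo (Eventually.of_forall fun s hs => ?_)
      exact heat_mono (fun y => ofReal_comp_toReal_mono hF (ih y s (hsub ht hs))
        (hpfin _ y s (hsub ht hs))) x
  set V : EuclideanSpace ℝ (Fin N) → ℝ → ℝ≥0∞ := fun x t => ⨆ n, picard θ F μ n x t with hV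
  have hVU : ∀ x, ∀ t ∈ Ioo 0 T, V x t ≤ U x t := fun x t ht => iSup_le fun n => hle n x t ht
  have hVfin : ∀ x, ∀ t ∈ Ioo 0 T, V x t ≠ ∞ := fun x t ht =>
    ne_top_of_le_ne_top (hfin x t ht) (hVU x t ht)
  have hVmeas : Measurable (Function.uncurry V) := by
    have : Function.uncurry V = fun z => ⨆ n, Function.uncurry (picard θ F μ n) z := rfl
    rw [this]
    exact Measurable.iSup fun n => measurable_picard hFc hμ n
  have hsrc : ∀ n, Measurable (Function.uncurry fun y s =>
      ENNReal.ofReal (F (picard θ F μ n y s).toReal)) := fun n =>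
    (measurable_ofReal_comp_toReal hFc).comp (measurable_picard hFc hμ n)
  have hfix : ∀ x, ∀ t ∈ Ioo 0 T, V x t = heat θ t μ x + ∫⁻ s in Ioo 0 t,
      heat θ (t - s) (fun y => ENNReal.ofReal (F (V y s).toReal)) x := by
    intro x t ht
    have h1 : V x t = ⨆ n, picard θ F μ (n + 1) x t := ((hmono x t ht).iSup_nat_add 1).symm
    have h2 : ∀ s ∈ Ioo 0 t, heat θ (t - s) (fun y => ENNReal.ofReal (F (V y s).toReal)) x =
        ⨆ n, heat θ (t - s) (fun y => ENNReal.ofReal (F (picard θ F μ n y s).toReal)) x := by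
      intro s hs
      have hsT := hsub ht hs
      have e : ∀ y, ENNReal.ofReal (F (V y s).toReal) =
          ⨆ n, ENNReal.ofReal (F (picard θ F μ n y s).toReal) := fun y =>
        ofReal_comp_toReal_iSup hFc hF (hmono y s hsT) (hVfin y s hsT)
      unfold heat
      rw [← lintegral_iSup]
      · congr 1 with y
        simp only [e, ENNReal.mul_iSup]
      · exact fun n => (measurable_ofReal_fundSol_sub x _).mul
          ((hsrc n).comp (f := fun y => (y, s)) (by fun_prop))
      · exact fun m n hmn y => mul_le_mul_right
          (ofReal_comp_toReal_mono hF (hmono y s hsT hmn) (hpfin n y s hsT)) _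
    rw [setLIntegral_congr_fun measurableSet_Ioo h2, lintegral_iSup', h1]
    · simp only [picard]
      rw [ENNReal.add_iSup]
    · intro n
      have hin : Measurable fun v : ℝ × EuclideanSpace ℝ (Fin N) =>
          ENNReal.ofReal (fundSol θ (x - v.2) (t - v.1)) *
            ENNReal.ofReal (F (picard θ F μ n v.2 v.1).toReal) :=
        (ENNReal.measurable_ofReal.comp (measurable_fundSol.comp
          (f := fun v : ℝ × EuclideanSpace ℝ (Fin N) => (x - v.2, t - v.1)) (by fun_prop))).mul
          ((hsrc n).comp (f := fun v : ℝ × EuclideanSpace ℝ (Fin N) => (v.2, v.1))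
            (by fun_prop))
      exact hin.lintegral_prod_right'.aemeasurable
    · filter_upwards [ae_restrict_mem measurableSet_Ioo] with s hs
      exact fun m n hmn => heat_mono (fun y => ofReal_comp_toReal_mono hF
        (hmono y s (hsub ht hs) hmn) (hpfin n y s (hsub ht hs))) x
  refine ⟨fun x t => (V x t).toReal, ⟨?_, fun x t _ => ENNReal.toReal_nonneg, ?_⟩,
    fun x t ht => ⟨ENNReal.toReal_nonneg, ?_⟩⟩
  · exact (hVmeas.ennreal_toReal).aemeasurable
  · have hms : MeasurableSet (cylinder N T) := MeasurableSet.univ.prod measurableSet_Ioo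
    filter_upwards [ae_restrict_mem hms] with z hz
    have hz2 : z.2 ∈ Ioo 0 T := hz.2
    rw [ENNReal.ofReal_toReal (hVfin _ _ hz2), semigroup_withDensity hμ]
    exact hfix z.1 z.2 hz2
  · rw [ENNReal.ofReal_toReal (hVfin _ _ ht)]
    exact hVU x t ht

end Iteration

/-! ### The supersolution -/

section Supersolution

variable {N : ℕ} {θ : ℝ} {F G : ℝ → ℝ} {R d p δ α : ℝ}

/-- The monotonicity of `τ^(-d) F(τ)` on `(R, ∞)` extends to the left endpoint. -/
theorem nonlinearity_le_rpow (hFmono : MonotoneOn F (Ici 0)) (hR : 0 ≤ R) (hd : 0 < d)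
    (hC1 : MonotoneOn (fun τ : ℝ => τ ^ (-d) * F τ) (Ioi R)) {ρ M : ℝ} (hρ : R ≤ ρ)
    (hρM : ρ ≤ M) (hM : R < M) : F ρ ≤ ρ ^ d * (M ^ (-d) * F M) := by
  have hM0 : 0 < M := hR.trans_lt hM
  rcases hρM.eq_or_lt with rfl | hlt
  · rw [← mul_assoc, ← Real.rpow_add hM0, add_neg_cancel, Real.rpow_zero, one_mul]
  -- Approaching ρ from the right stays inside (R, ∞) even when ρ = R; monotonicity of F makes its
  -- continuity unnecessary.
  · have hlim : Tendsto (fun τ : ℝ => τ ^ d * (M ^ (-d) * F M)) (𝓝[>] ρ)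
        (𝓝 (ρ ^ d * (M ^ (-d) * F M))) :=
      (((Real.continuousAt_rpow_const ρ d (Or.inr hd.le)).tendsto).mono_left
        nhdsWithin_le_nhds).mul_const _
    refine ge_of_tendsto hlim ?_
    filter_upwards [Ioo_mem_nhdsGT hlt] with τ hτ
    have hτ0 : 0 < τ := (hR.trans hρ).trans_lt hτ.1
    calc F ρ ≤ F τ := hFmono (hR.trans hρ) hτ0.le hτ.1.le
      _ = τ ^ d * (τ ^ (-d) * F τ) := by
        rw [← mul_assoc, ← Real.rpow_add hτ0, add_neg_cancel, Real.rpow_zero, one_mul]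
      _ ≤ τ ^ d * (M ^ (-d) * F M) :=
        mul_le_mul_of_nonneg_left (hC1 (hρ.trans_lt hτ.1) hM hτ.2.le) (by positivity)

/-- If `R ≤ w ≤ 4bh ≤ h` then `F(w)` is controlled by `w^α` and the value of `F` at `h`. -/
theorem nonlinearity_le_of_le_mul (hFmono : MonotoneOn F (Ici 0))
    (hR : 0 ≤ R) (hd : 0 < d) (hC1 : MonotoneOn (fun τ : ℝ => τ ^ (-d) * F τ) (Ioi R))
    (hα : 0 < α) (hαd : α ≤ d) {b h w K : ℝ} (hb : 0 < b) (hb4 : 4 * b ≤ 1) (hh : 0 < h)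
    (hRh : R < 4 * b * h) (hw : R ≤ w) (hwM : w ≤ 4 * b * h) (hFh : F h ≤ K * h) (hK : 0 ≤ K) :
    F w ≤ (4 * b) ^ (d - α) * (h ^ (1 - α) * K) * w ^ α := by
  have hw0 : 0 ≤ w := hR.trans hw
  have hMh : 4 * b * h ≤ h := by nlinarith
  have hM0 : 0 < 4 * b * h := by positivity
  have h1 := nonlinearity_le_rpow hFmono hR hd hC1 hw hwM hRh
  have h2 : (4 * b * h) ^ (-d) * F (4 * b * h) ≤ h ^ (-d) * F h :=
    hC1 hRh (hRh.trans_le hMh) hMh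
  -- The surplus power d - α ≥ 0 of w is spent on w ≤ 4bh, producing the small factor (4b)^(d-α).
  have h3 : w ^ d ≤ w ^ α * (4 * b * h) ^ (d - α) := by
    calc w ^ d = w ^ α * w ^ (d - α) := by
          rw [← Real.rpow_add_of_nonneg hw0 hα.le (by linarith)]
          congr 1
          ring
      _ ≤ _ := by gcongr
  calc F w ≤ w ^ d * (h ^ (-d) * F h) := h1.trans (by gcongr)
    _ ≤ w ^ d * (h ^ (-d) * (K * h)) := by gcongr
    _ ≤ (w ^ α * (4 * b * h) ^ (d - α)) * (h ^ (-d) * (K * h)) := by gcongr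
    _ = _ := by
      have e : h ^ (1 - α) = h ^ (d - α) * (h ^ (-d) * h) := by
        nth_rewrite 4 [← Real.rpow_one h]
        rw [← Real.rpow_add hh, ← Real.rpow_add hh]
        congr 1
        ring
      rw [Real.mul_rpow (by positivity) hh.le, e]
      ring

/-- Under a pointwise smallness condition on `S(t)μ^α`, the function `2 (S(t)μ^α)^(1/α) + R` is a
supersolution, so that a solution exists below it. -/
theorem exists_isSolution_of_heat_rpow_le (hN : 1 ≤ N) (hθ : 0 < θ) (hθ2 : θ ≤ 2)
    (hFcont : ContinuousOn F (Ici 0)) (hFmono : MonotoneOn F (Ici 0))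
    (hR : 0 ≤ R) (hd : 1 < d) (hC1 : MonotoneOn (fun τ : ℝ => τ ^ (-d) * F τ) (Ioi R))
    (hp : 1 < p) (hC2 : AsympLE (fun τ => τ ^ (-p) * F τ) G)
    (hC2pos : ∀ᶠ τ in atTop, 0 < τ ^ (-p) * F τ)
    (hC3 : ∀ a b c : ℝ, 1 ≤ a → 0 < b → AsympEq (fun τ => G (a * τ ^ b * G τ ^ c)) G)
    (hδ : δ < 1) (hC4 : AntitoneOn (fun τ : ℝ => τ ^ (-δ) * G τ) (Ioi R))
    (hα : 1 < α) (hαd : α ≤ d) :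
    ∃ b : ℝ, 0 < b ∧ ∀ μ : EuclideanSpace ℝ (Fin N) → ℝ≥0∞, Measurable μ →
      (∀ᶠ t in 𝓝[>] (0 : ℝ), ∀ x, heat θ t (fun y => μ y ^ α) x ^ (1 / α) ≤
        ENNReal.ofReal (b * profile G p t)) →
      ∃ T : ℝ, 0 < T ∧ ∃ u : EuclideanSpace ℝ (Fin N) → ℝ → ℝ,
        IsSolution θ F (volume.withDensity μ) T u ∧ ∀ x, ∀ t ∈ Ioo 0 T, 0 ≤ u x t ∧
          ENNReal.ofReal (u x t) ≤ 2 * heat θ t (fun y => μ y ^ α) x ^ (1 / α) +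
            ENNReal.ofReal R := by
  obtain ⟨C₁, hC₁, hF₁⟩ := eventually_nonlinearity_profile_le hp hδ hC2 hC2pos hC3 hC4
  have hG := eventually_pos_of_asympLE hC2 hC2pos
  have hlim := tendsto_profile hp hG hδ hC4
  set C₂ := 1 / ((1 - δ) * ((α - 1) / (p - 1))) with hC₂def
  have hC₂ : 0 < C₂ := by
    have : 0 < (1 - δ) * ((α - 1) / (p - 1)) :=
      mul_pos (by linarith) (div_pos (by linarith) (by linarith))
    positivity
  -- The bound 1/4 keeps 4bh ≤ h; the other makes the total Duhamel constant 4^d C₁ C₂ b^(d-1) at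
  -- most 1.
  set b := min (1 / 4) ((4 ^ d * C₁ * C₂)⁻¹ ^ (1 / (d - 1))) with hbdef
  have hb : 0 < b := by positivity
  have hb4 : 4 * b ≤ 1 := by
    have := min_le_left (1 / 4) ((4 ^ d * C₁ * C₂)⁻¹ ^ (1 / (d - 1)))
    linarith
  have hbsmall : 4 ^ d * C₁ * C₂ * b ^ (d - 1) ≤ 1 := by
    have h1 : b ^ (d - 1) ≤ (4 ^ d * C₁ * C₂)⁻¹ := by
      calc b ^ (d - 1) ≤ ((4 ^ d * C₁ * C₂)⁻¹ ^ (1 / (d - 1))) ^ (d - 1) :=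
            Real.rpow_le_rpow hb.le (min_le_right _ _) (by linarith)
        _ = _ := by
          rw [← Real.rpow_mul (by positivity), one_div_mul_cancel (by linarith), Real.rpow_one]
    calc _ ≤ 4 ^ d * C₁ * C₂ * (4 ^ d * C₁ * C₂)⁻¹ := by gcongr
      _ = 1 := mul_inv_cancel₀ (by positivity)
  refine ⟨b, hb, fun μ hμ hsmall => ?_⟩
  have hμα : Measurable fun y => μ y ^ α := hμ.pow_const α
  have hev := hF₁.and <| (tendsto_inv_nhdsGT_zero.eventually hG).and <|
    (hlim.eventually (eventually_gt_atTop (R / (2 * b)))).and <| hsmall.and <|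
    tendsto_inv_nhdsGT_zero.eventually (eventually_gt_atTop R)
  obtain ⟨T, hT, hTsub⟩ := (mem_nhdsGT_iff_exists_Ioo_subset).1 hev
  refine ⟨T, hT, ?_⟩
  set h := profile G p with hh
  set V : EuclideanSpace ℝ (Fin N) → ℝ → ℝ≥0∞ := fun x t => heat θ t (fun y => μ y ^ α) x with hV
  have hα0 : 0 < α := by linarith
  have hpos : ∀ t ∈ Ioo 0 T, 0 < h t := fun t ht => profile_pos ht.1 (hTsub ht).2.1
  have hRh : ∀ t ∈ Ioo 0 T, R < 2 * b * h t := fun t ht => by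
    have := (hTsub ht).2.2.1
    rw [div_lt_iff₀ (by positivity)] at this
    linarith
  have hVle : ∀ x, ∀ t ∈ Ioo 0 T, V x t ^ (1 / α) ≤ ENNReal.ofReal (b * h t) := fun x t ht =>
    (hTsub ht).2.2.2.1 x
  have hUle : ∀ x, ∀ t ∈ Ioo 0 T, 2 * V x t ^ (1 / α) + ENNReal.ofReal R ≤
      ENNReal.ofReal (4 * b * h t) := by
    intro x t ht
    have h1 := hpos t ht
    have h2 := hRh t ht
    calc _ ≤ 2 * ENNReal.ofReal (b * h t) + ENNReal.ofReal (2 * b * h t) := by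
          gcongr
          exact hVle x t ht
      _ = _ := by
          rw [← ENNReal.ofReal_ofNat, ← ENNReal.ofReal_mul (by norm_num),
            ← ENNReal.ofReal_add (by positivity) (by positivity)]
          congr 1
          ring
  refine exists_isSolution_of_supersolution
    (U := fun x t => 2 * V x t ^ (1 / α) + ENNReal.ofReal R) hFcont hFmono hμ
    (fun x t ht => ne_top_of_le_ne_top ENNReal.ofReal_ne_top (hUle x t ht)) ?_
  intro x t ht
  have ht0 : 0 < t := ht.1
  have hht := hpos t ht
  set k := (4 * b) ^ (d - α) * C₁ with hk
  have hk0 : 0 ≤ k := by positivity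
  have hsrc : ∀ s ∈ Ioo 0 T, ∀ y,
      ENNReal.ofReal (F (2 * V y s ^ (1 / α) + ENNReal.ofReal R).toReal) ≤
        ENNReal.ofReal (k * (h s ^ (1 - α) * s⁻¹)) *
          (2 ^ (α - 1) * (2 ^ α * V y s + ENNReal.ofReal R ^ α)) := by
    intro s hs y
    have hs0 : 0 < s := hs.1
    have hhs := hpos s hs
    set W := 2 * V y s ^ (1 / α) + ENNReal.ofReal R with hW
    have hWfin : W ≠ ∞ := ne_top_of_le_ne_top ENNReal.ofReal_ne_top (hUle y s hs)
    have hRW : R ≤ W.toReal := (ENNReal.ofReal_le_iff_le_toReal hWfin).1 (le_add_left le_rfl)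
    have hWM : W.toReal ≤ 4 * b * h s :=
      ENNReal.toReal_le_of_le_ofReal (by positivity) (hUle y s hs)
    have hreal := nonlinearity_le_of_le_mul (K := C₁ * s⁻¹) hFmono hR (by linarith) hC1 hα0 hαd hb
      hb4 hhs (by linarith [hRh s hs, mul_pos hb hhs]) hRW hWM
      ((hTsub hs).1.trans_eq (by ring)) (by positivity)
    calc ENNReal.ofReal (F W.toReal)
        ≤ ENNReal.ofReal (k * (h s ^ (1 - α) * s⁻¹) * W.toReal ^ α) := by
          refine ENNReal.ofReal_le_ofReal (hreal.trans_eq ?_)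
          rw [hk]
          ring
      _ = ENNReal.ofReal (k * (h s ^ (1 - α) * s⁻¹)) * W ^ α := by
          rw [ENNReal.ofReal_mul (by positivity),
            ← ENNReal.ofReal_rpow_of_nonneg ENNReal.toReal_nonneg hα0.le,
            ENNReal.ofReal_toReal hWfin]
      _ ≤ _ := by
          gcongr
          refine (ENNReal.rpow_add_le_mul_rpow_add_rpow _ _ hα.le).trans_eq ?_
          rw [ENNReal.mul_rpow_of_nonneg _ _ hα0.le, ← ENNReal.rpow_mul,
            one_div_mul_cancel hα0.ne', ENNReal.rpow_one]
  -- In the next bound, the semigroup law and mass one make S(t-s) of the bracket independent of s,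
  -- apart from the scalar prefactor.
  have hVm : ∀ s, Measurable fun y => V y s := fun s => measurable_heat hμα
  have hheat : ∀ s ∈ Ioo 0 t, heat θ (t - s) (fun y =>
      ENNReal.ofReal (F (2 * V y s ^ (1 / α) + ENNReal.ofReal R).toReal)) x ≤
      ENNReal.ofReal (k * (h s ^ (1 - α) * s⁻¹)) *
        (2 ^ (α - 1) * (2 ^ α * V x t + ENNReal.ofReal R ^ α)) := by
    intro s hs
    have hts : 0 < t - s := sub_pos.2 hs.2
    refine (heat_mono (hsrc s ⟨hs.1, hs.2.trans ht.2⟩) x).trans_eq ?_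
    have hm1 : Measurable fun y => 2 ^ α * V y s := (hVm s).const_mul _
    have hm2 : Measurable fun y => 2 ^ α * V y s + ENNReal.ofReal R ^ α := hm1.add_const _
    rw [heat_const_mul (hm2.const_mul _), heat_const_mul hm2, heat_add hm1,
      heat_const_mul (hVm s), heat_const hN hθ hθ2 hts]
    have := heat_heat hN hθ hθ2 hts hs.1 hμα x
    rw [sub_add_cancel] at this
    simp only [hV]
    rw [← this]
  have hprof := lintegral_profile_rpow_le (G := G) hp hδ hC4 hα ht0
    ((hTsub ht).2.2.2.2) (fun s hs => (hTsub ⟨hs.1, hs.2.trans_lt ht.2⟩).2.1)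
  have hint : ∫⁻ s in Ioo 0 t, heat θ (t - s) (fun y =>
      ENNReal.ofReal (F (2 * V y s ^ (1 / α) + ENNReal.ofReal R).toReal)) x ≤
      ENNReal.ofReal (k * (C₂ * h t ^ (1 - α))) *
        (2 ^ (α - 1) * (2 ^ α * V x t + ENNReal.ofReal R ^ α)) := by
    have hfin : 2 ^ (α - 1) * (2 ^ α * V x t + ENNReal.ofReal R ^ α) ≠ ∞ := by
      have hVfin : V x t ≠ ∞ := by
        have h1 : V x t ^ (1 / α) ≠ ∞ := ne_top_of_le_ne_top ENNReal.ofReal_ne_top (hVle x t ht)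
        intro h2
        rw [h2, ENNReal.top_rpow_of_pos (by positivity)] at h1
        exact h1 rfl
      have hc : ∀ r : ℝ, 0 ≤ r → (2 : ℝ≥0∞) ^ r ≠ ∞ := fun r hr =>
        ENNReal.rpow_ne_top_of_nonneg hr (by norm_num)
      exact ENNReal.mul_ne_top (hc _ (by linarith)) (ENNReal.add_ne_top.2
        ⟨ENNReal.mul_ne_top (hc _ hα0.le) hVfin,
          ENNReal.rpow_ne_top_of_nonneg hα0.le ENNReal.ofReal_ne_top⟩)
    refine (setLIntegral_mono_ae' measurableSet_Ioo (Eventually.of_forall hheat)).trans ?_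
    rw [lintegral_mul_const' _ _ hfin]
    gcongr
    simp only [ENNReal.ofReal_mul hk0]
    rw [lintegral_const_mul' _ _ ENNReal.ofReal_ne_top]
    gcongr
  -- Write V = V^(1/α) · (V^(1/α))^(α-1) and use V^(1/α) ≤ bh in the second factor.
  have hV1 : ENNReal.ofReal (h t ^ (1 - α)) * V x t ≤
      ENNReal.ofReal (b ^ (α - 1)) * V x t ^ (1 / α) := by
    set v := V x t ^ (1 / α) with hv
    have hvV : V x t = v * v ^ (α - 1) := by
      have hvα : V x t = v ^ α := by
        rw [hv, ← ENNReal.rpow_mul, one_div_mul_cancel hα0.ne', ENNReal.rpow_one]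
      rw [hvα]
      nth_rewrite 2 [← ENNReal.rpow_one v]
      rw [← ENNReal.rpow_add_of_nonneg _ _ zero_le_one (by linarith)]
      congr 1
      ring
    have hvle : v ^ (α - 1) ≤ ENNReal.ofReal ((b * h t) ^ (α - 1)) := by
      rw [← ENNReal.ofReal_rpow_of_nonneg (by positivity) (by linarith)]
      exact ENNReal.rpow_le_rpow (hVle x t ht) (by linarith)
    calc _ ≤ ENNReal.ofReal (h t ^ (1 - α)) * (v * ENNReal.ofReal ((b * h t) ^ (α - 1))) := by
          rw [hvV]
          gcongr
      _ = ENNReal.ofReal (h t ^ (1 - α) * (b * h t) ^ (α - 1)) * v := by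
          rw [ENNReal.ofReal_mul (by positivity)]
          ring
      _ = _ := by
          congr 2
          rw [Real.mul_rpow hb.le hht.le, mul_left_comm, ← Real.rpow_add hht]
          simp
  -- The same splitting for R, with R < 2bh.
  have hR1 : h t ^ (1 - α) * R ^ α ≤ (2 * b) ^ (α - 1) * R := by
    have hRα : R ^ α = R * R ^ (α - 1) := by
      nth_rewrite 2 [← Real.rpow_one R]
      rw [← Real.rpow_add_of_nonneg hR zero_le_one (by linarith)]
      congr 1
      ring
    calc _ ≤ h t ^ (1 - α) * (R * (2 * b * h t) ^ (α - 1)) := by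
          rw [hRα]
          have := (hRh t ht).le
          have : R ^ (α - 1) ≤ (2 * b * h t) ^ (α - 1) :=
            Real.rpow_le_rpow hR this (by linarith)
          gcongr
      _ = (2 * b) ^ (α - 1) * R * (h t ^ (1 - α) * h t ^ (α - 1)) := by
          rw [Real.mul_rpow (by positivity) hht.le]
          ring
      _ = _ := by
          rw [← Real.rpow_add hht]
          simp
  -- The powers of b add up to (d-α) + (α-1) = d-1, and 4^(d-α) 4^α = 4^d, matching the choice of b.
  have hkb : k * C₂ * b ^ (α - 1) * (2 ^ (α - 1) * 2 ^ α) ≤ 1 := by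
    refine le_trans ?_ hbsmall
    have e1 : (4 * b) ^ (d - α) * b ^ (α - 1) = 4 ^ (d - α) * b ^ (d - 1) := by
      rw [Real.mul_rpow (by norm_num) hb.le, mul_assoc, ← Real.rpow_add hb]
      congr 2
      ring
    have e2 : (2 : ℝ) ^ (α - 1) * 2 ^ α ≤ 4 ^ α := by
      rw [← Real.rpow_add two_pos, show (4 : ℝ) = 2 ^ (2 : ℝ) by norm_num, ← Real.rpow_mul two_pos.le]
      exact Real.rpow_le_rpow_of_exponent_le one_le_two (by linarith)
    have e3 : (4 : ℝ) ^ (d - α) * 4 ^ α = 4 ^ d := by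
      rw [← Real.rpow_add (by norm_num), sub_add_cancel]
    calc _ = ((4 * b) ^ (d - α) * b ^ (α - 1)) * C₁ * C₂ * (2 ^ (α - 1) * 2 ^ α) := by
          rw [hk]; ring
      _ ≤ ((4 * b) ^ (d - α) * b ^ (α - 1)) * C₁ * C₂ * 4 ^ α := by gcongr
      _ = _ := by rw [e1, ← e3]; ring
  have htwo : ∀ r : ℝ, 0 ≤ r → (2 : ℝ≥0∞) ^ r = ENNReal.ofReal (2 ^ r) := fun r hr => by
    rw [← ENNReal.ofReal_rpow_of_nonneg two_pos.le hr, ENNReal.ofReal_ofNat]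
  have hD : ENNReal.ofReal (k * (C₂ * h t ^ (1 - α))) *
      (2 ^ (α - 1) * (2 ^ α * V x t + ENNReal.ofReal R ^ α)) ≤
      V x t ^ (1 / α) + ENNReal.ofReal R := by
    calc _ = ENNReal.ofReal (k * C₂ * (2 ^ (α - 1) * 2 ^ α)) *
            (ENNReal.ofReal (h t ^ (1 - α)) * V x t) +
          ENNReal.ofReal (k * C₂ * 2 ^ (α - 1) * (h t ^ (1 - α) * R ^ α)) := by
          rw [htwo _ (by linarith), htwo _ hα0.le, ENNReal.ofReal_rpow_of_nonneg hR hα0.le]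
          have h2a : (0 : ℝ) ≤ 2 ^ (α - 1) := by positivity
          have hha : 0 ≤ h t ^ (1 - α) := by positivity
          rw [ENNReal.ofReal_mul (p := k * C₂ * 2 ^ (α - 1)) (by positivity),
            ENNReal.ofReal_mul (p := k * C₂) (by positivity),
            ENNReal.ofReal_mul (p := k * C₂) (by positivity), ENNReal.ofReal_mul hk0,
            ENNReal.ofReal_mul hk0, ENNReal.ofReal_mul hC₂.le, ENNReal.ofReal_mul h2a,
            ENNReal.ofReal_mul hha]
          ring
      _ ≤ ENNReal.ofReal (k * C₂ * (2 ^ (α - 1) * 2 ^ α)) *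
            (ENNReal.ofReal (b ^ (α - 1)) * V x t ^ (1 / α)) +
          ENNReal.ofReal (k * C₂ * 2 ^ (α - 1) * ((2 * b) ^ (α - 1) * R)) := by
          gcongr
      _ = ENNReal.ofReal (k * C₂ * b ^ (α - 1) * (2 ^ (α - 1) * 2 ^ α)) * V x t ^ (1 / α) +
          ENNReal.ofReal (k * C₂ * b ^ (α - 1) * (2 ^ (α - 1) * 2 ^ (α - 1)) * R) := by
          congr 1
          · rw [← mul_assoc, ← ENNReal.ofReal_mul (by positivity)]
            congr 2
            ring
          · congr 1
            rw [Real.mul_rpow two_pos.le hb.le]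
            ring
      _ ≤ 1 * V x t ^ (1 / α) + ENNReal.ofReal R := by
          refine add_le_add (mul_le_mul_left (ENNReal.ofReal_le_one.2 hkb) _)
            (ENNReal.ofReal_le_ofReal (mul_le_of_le_one_left hR (le_trans ?_ hkb)))
          gcongr
          · norm_num
          · linarith
      _ = _ := by rw [one_mul]
  have hJ : heat θ t μ x ≤ V x t ^ (1 / α) := by
    have := heat_rpow_le hN hθ hθ2 ht0 hμ one_pos hα.le x
    simpa using this
  calc _ ≤ V x t ^ (1 / α) + (V x t ^ (1 / α) + ENNReal.ofReal R) :=
        add_le_add hJ (hint.trans hD)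
    _ = _ := by ring

/-- The averaging condition on `μ` bounds `(S(t)μ^α)^(1/α)` by the scale function. -/
theorem eventually_heat_rpow_le (hN : 1 ≤ N) (hθ : 0 < θ) (hθ2 : θ ≤ 2) (hp : 1 < p)
    (hG : ∀ᶠ τ in atTop, 0 < G τ)
    (hC3 : ∀ a b c : ℝ, 1 ≤ a → 0 < b → AsympEq (fun τ => G (a * τ ^ b * G τ ^ c)) G)
    (hα : 0 < α) :
    ∃ κ : ℝ, 0 < κ ∧ ∀ ε : ℝ, 0 < ε → ∀ μ : EuclideanSpace ℝ (Fin N) → ℝ≥0∞, Measurable μ →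
      (∀ᶠ σ : ℝ in 𝓝[>] 0, (⨆ x : EuclideanSpace ℝ (Fin N),
        (⨍⁻ y in Metric.ball x σ, μ y ^ α ∂volume) ^ (1 / α)) ≤
          ENNReal.ofReal (ε * σ ^ (-(θ / (p - 1))) * G σ⁻¹ ^ (-(1 / (p - 1))))) →
      ∀ᶠ t in 𝓝[>] (0 : ℝ), ∀ x, heat θ t (fun y => μ y ^ α) x ^ (1 / α) ≤
        ENNReal.ofReal (κ * ε * profile G p t) := by
  obtain ⟨C, hC, hheat⟩ := heat_le_iSup_setLAverage (N := N) hN hθ hθ2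
  obtain ⟨C₃, hC₃, hscale⟩ := eventually_scaled_profile_le hp hθ hG hC3
  refine ⟨C ^ (1 / α) * C₃, by positivity, fun ε hε μ hμ hμε => ?_⟩
  have hlim : Tendsto (fun t : ℝ => t ^ (1 / θ)) (𝓝[>] 0) (𝓝[>] 0) := by
    refine tendsto_nhdsWithin_iff.2 ⟨?_, ?_⟩
    · have := ((Real.continuousAt_rpow_const 0 (1 / θ)
        (Or.inr (by positivity))).tendsto).mono_left (nhdsWithin_le_nhds (s := Ioi 0))
      rwa [Real.zero_rpow (by positivity)] at this
    · filter_upwards [self_mem_nhdsWithin] with t (ht : 0 < t)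
      exact Real.rpow_pos_of_pos ht _
  filter_upwards [hscale, hlim.eventually hμε, self_mem_nhdsWithin] with t h1 h2 (ht : 0 < t) x
  set σ := t ^ (1 / θ) with hσ
  set B := ENNReal.ofReal (ε * (C₃ * profile G p t)) with hB
  have hBle : ∀ z : EuclideanSpace ℝ (Fin N),
      (⨍⁻ y in Metric.ball z σ, μ y ^ α ∂volume) ^ (1 / α) ≤ B := fun z => by
    refine ((le_iSup (fun z : EuclideanSpace ℝ (Fin N) =>
      (⨍⁻ y in Metric.ball z σ, μ y ^ α ∂volume) ^ (1 / α)) z).trans h2).trans ?_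
    refine ENNReal.ofReal_le_ofReal ?_
    rw [mul_assoc]
    exact mul_le_mul_of_nonneg_left h1 hε.le
  have hsup : ⨆ z : EuclideanSpace ℝ (Fin N), ⨍⁻ y in Metric.ball z σ, μ y ^ α ∂volume ≤
      B ^ α := iSup_le fun z => by
    have := ENNReal.rpow_le_rpow (hBle z) hα.le
    rwa [← ENNReal.rpow_mul, one_div_mul_cancel hα.ne', ENNReal.rpow_one] at this
  have h3 := (hheat t ht _ (hμ.pow_const α) x).trans (mul_le_mul_right hsup _)
  refine (ENNReal.rpow_le_rpow h3 (by positivity : 0 ≤ 1 / α)).trans_eq ?_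
  rw [ENNReal.mul_rpow_of_nonneg _ _ (by positivity), ← ENNReal.rpow_mul,
    mul_one_div_cancel hα.ne', ENNReal.rpow_one,
    ENNReal.ofReal_rpow_of_nonneg hC.le (by positivity), hB,
    ← ENNReal.ofReal_mul (by positivity)]
  congr 1
  ring

end Supersolution

end FracHeat

/-! ### Reduction to an exponent at most d, and choice of the constants -/

theorem theorem4p3 (N : ℕ) (hN : 1 ≤ N) (θ : ℝ) (hθ : 0 < θ) (hθ2 : θ ≤ 2)
    -- `F` is an increasing, nonnegative continuous function in `[0, ∞)`
    (F : ℝ → ℝ) (hFcont : ContinuousOn F (Ici 0)) (hFmono : MonotoneOn F (Ici 0))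
    (hFnonneg : ∀ τ, 0 ≤ τ → 0 ≤ F τ)
    -- (C1)
    (R : ℝ) (hR : 0 ≤ R) (d : ℝ) (hd : 1 < d)
    (hC1pos : ∀ τ ∈ Ioi R, 0 < τ ^ (-d) * F τ)
    (hC1 : MonotoneOn (fun τ : ℝ => τ ^ (-d) * F τ) (Ioi R))
    -- `G` is continuous in `[R, ∞)`
    (G : ℝ → ℝ) (hGcont : ContinuousOn G (Ici R))
    -- (C2)
    (p : ℝ) (hp : p ∈ Ico d (d + 1))
    (hC2 : FracHeat.AsympLE (fun τ => τ ^ (-p) * F τ) G)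
    (hC2pos : ∀ᶠ τ in atTop, 0 < τ ^ (-p) * F τ)
    -- (C3)
    (hC3 : ∀ a b c : ℝ, 1 ≤ a → 0 < b →
      FracHeat.AsympEq (fun τ => G (a * τ ^ b * G τ ^ c)) G)
    -- (C4)
    (δ : ℝ) (hδ : δ ∈ Ioo (0 : ℝ) 1)
    (hC4 : AntitoneOn (fun τ : ℝ => τ ^ (-δ) * G τ) (Ioi R))
    (α : ℝ) (hα : 1 < α) :
    ∃ ε : ℝ, 0 < ε ∧
      ∀ μ : EuclideanSpace ℝ (Fin N) → ℝ≥0∞, AEMeasurable μ volume →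
        (∀ᶠ σ : ℝ in 𝓝[>] 0,
          (⨆ x : EuclideanSpace ℝ (Fin N),
              (⨍⁻ y in Metric.ball x σ, μ y ^ α ∂volume) ^ (1 / α)) ≤
            ENNReal.ofReal (ε * σ ^ (-(θ / (p - 1))) * G σ⁻¹ ^ (-(1 / (p - 1))))) →
        ∃ T : ℝ, 0 < T ∧ ∃ u : EuclideanSpace ℝ (Fin N) → ℝ → ℝ,
          FracHeat.IsSolution θ F (volume.withDensity μ) T u ∧
          ∃ C : ℝ, 0 < C ∧ ∀ x, ∀ t ∈ Ioo 0 T,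
            0 ≤ u x t ∧
            ENNReal.ofReal (u x t) ≤
              2 * FracHeat.semigroup θ t (volume.withDensity fun y => μ y ^ α) x ^ (1 / α) +
                ENNReal.ofReal R ∧
            2 * FracHeat.semigroup θ t (volume.withDensity fun y => μ y ^ α) x ^ (1 / α) +
                ENNReal.ofReal R ≤
              ENNReal.ofReal (C * t ^ (-(1 / (p - 1))) * G t⁻¹ ^ (-(1 / (p - 1)))) := by
  have hp1 : 1 < p := hd.trans_le hp.1
  have hG := FracHeat.eventually_pos_of_asympLE hC2 hC2pos
  have hα0 : 0 < α := by linarith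
  -- The supersolution needs 1 < α' ≤ d, and (1+d)/2 lies strictly between 1 and d. Jensen passes
  -- the smallness from α to α', and later the bound on u from α' back to α.
  set α' := min α ((1 + d) / 2) with hα'def
  have hα' : 1 < α' := lt_min hα (by linarith)
  have hα'd : α' ≤ d := (min_le_right _ _).trans (by linarith)
  have hα'α : α' ≤ α := min_le_left _ _
  obtain ⟨b, hb, hsol⟩ := FracHeat.exists_isSolution_of_heat_rpow_le hN hθ hθ2 hFcont hFmono hR
    hd hC1 hp1 hC2 hC2pos hC3 hδ.2 hC4 hα' hα'd
  obtain ⟨κ, hκ, hheat⟩ := FracHeat.eventually_heat_rpow_le hN hθ hθ2 hp1 hG hC3 hα0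
  refine ⟨b / κ, by positivity, fun μ₀ hμ₀ hμε => ?_⟩
  -- A Borel representative; averages and densities do not see the null set.
  obtain ⟨μ, hμ, hae⟩ := hμ₀
  have haeα : (fun y => μ₀ y ^ α) =ᵐ[volume] fun y => μ y ^ α :=
    hae.mono fun y hy => by simp only [hy]
  have havg : ∀ (x : EuclideanSpace ℝ (Fin N)) σ, ⨍⁻ y in Metric.ball x σ, μ₀ y ^ α ∂volume =
      ⨍⁻ y in Metric.ball x σ, μ y ^ α ∂volume := fun x σ =>
    laverage_congr (ae_restrict_of_ae haeα)
  simp only [havg] at hμε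
  rw [withDensity_congr_ae hae, withDensity_congr_ae haeα]
  have hev := hheat (b / κ) (by positivity) μ hμ hμε
  rw [mul_div_cancel₀ b hκ.ne'] at hev
  have hev' : ∀ᶠ t in 𝓝[>] (0 : ℝ), ∀ x, FracHeat.heat θ t (fun y => μ y ^ α') x ^ (1 / α') ≤
      ENNReal.ofReal (b * FracHeat.profile G p t) := by
    filter_upwards [hev, self_mem_nhdsWithin] with t h1 (ht : 0 < t) x
    exact (FracHeat.heat_rpow_le hN hθ hθ2 ht hμ (by linarith) hα'α x).trans (h1 x)
  obtain ⟨T₁, hT₁, u, hu, hbound⟩ := hsol μ hμ hev'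
  have hprof := FracHeat.tendsto_profile hp1 hG hδ.2 hC4
  -- On (0, T₂) the profile h satisfies h ≥ R/b, so R ≤ bh, and h ≥ 0.
  obtain ⟨T₂, hT₂, hTsub⟩ := mem_nhdsGT_iff_exists_Ioo_subset.1
    (hev.and (hprof.eventually (eventually_ge_atTop (max 0 (R / b)))))
  have hT₂' : 0 < T₂ := hT₂
  have hsubset : Ioo 0 (min T₁ T₂) ⊆ Ioo 0 T₁ := Ioo_subset_Ioo_right (min_le_left _ _)
  have hcyl : FracHeat.cylinder N (min T₁ T₂) ⊆ FracHeat.cylinder N T₁ :=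
    prod_mono subset_rfl hsubset
  -- The constant 3b is 2b from 2 V^(1/α) ≤ 2bh plus b from R ≤ bh.
  refine ⟨min T₁ T₂, lt_min hT₁ hT₂', u, ⟨hu.aemeasurable.mono_measure
    (Measure.restrict_mono hcyl le_rfl), fun x t ht => hu.nonneg x t (hsubset ht),
    ae_restrict_of_ae_restrict_of_subset hcyl hu.integral_eq⟩, 3 * b, by positivity,
    fun x t ht => ?_⟩
  have ht0 : 0 < t := ht.1
  obtain ⟨h1, h2⟩ := hTsub (Ioo_subset_Ioo_right (min_le_right _ _) ht)
  have hR2 : R ≤ b * FracHeat.profile G p t := by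
    have := (le_max_right _ _).trans h2
    rwa [div_le_iff₀ hb, mul_comm] at this
  have hpr0 : 0 ≤ FracHeat.profile G p t := (le_max_left _ _).trans h2
  rw [FracHeat.semigroup_withDensity (hμ.pow_const α)]
  refine ⟨(hbound x t (hsubset ht)).1, (hbound x t (hsubset ht)).2.trans ?_, ?_⟩
  · gcongr
    exact FracHeat.heat_rpow_le hN hθ hθ2 ht0 hμ (by linarith) hα'α x
  · calc _ ≤ 2 * ENNReal.ofReal (b * FracHeat.profile G p t) +
          ENNReal.ofReal (b * FracHeat.profile G p t) := by
          gcongr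
          exact h1 x
      _ = _ := by
          rw [← ENNReal.ofReal_ofNat, ← ENNReal.ofReal_mul (by norm_num),
            ← ENNReal.ofReal_add (by positivity) (by positivity)]
          congr 1
          simp only [FracHeat.profile]
          ring
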